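/- Let $\mathbb{K}$ be a field. For a $\mathbb{K}$-algebra $R$, a $\mathbb{K}$-algebra automorphism $\sigma$ of $R$ and a $\mathbb{K}$-linear $\sigma$-derivation $\delta$ of $R$ (so $\delta(ab)=\sigma(a)\delta(b)+\delta(a)b$), the Ore extension $R[x;\sigma,\delta]$ has the relations $xr=\sigma(r)x+\delta(r)$ for $r\in R$; write $R[x;\sigma]$ for $R[x;\sigma,0]$. For $q\in\mathbb{K}^*$, $q\neq 1$, one says that $\delta$ extends to a higher $q$-skew $\sigma$-derivation $\{d_n\}_{n\ge 0}$ on $R$ if the $d_n$ are $\mathbb{K}$-linear operators on $R$ with $d_0=\mathrm{id}$, $d_1=\delta$, $d_n(rs)=\sum_{i=0}^n\sigma^{n-i}d_i(r)\,d_{n-i}(s)$ and $d_n\circ\sigma=q^n\sigma\circ d_n$ for all $n$. It is locally nilpotent if for each $r\in R$ one has $d_n(r)=0$ for all sufficiently large $n$, and iterative if $d_nd_m=\binom{n+m}{m}_q d_{n+m}$ for all $n,m$, where $\binom{n+m}{m}_q$ is the Gaussian binomial coefficient (a polynomial in $q$ over $\mathbb{Z}$). **Hypothesis 1.** $A=\mathbb{K}[X_1][X_2;\sigma_2,\delta_2]\cdots[X_N;\sigma_N,\delta_N]$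 is an iterated Ore extension with $\mathbb{K}$-algebra automorphisms $\sigma_i$ and $\sigma_i$-derivations $\delta_i$ of $A_{i-1}=\mathbb{K}[X_1]\cdots[X_{i-1};\sigma_{i-1},\delta_{i-1}]$, where $A_0=\mathbb{K}$ and $A_N=A$, such that: 1. $\sigma_i(X_l)=\lambda_{i,l}X_l$ for all $l<i$, $2\le i\le N$, with $\lambda_{i,l}\in\mathbb{K}^*$; 2. $\lambda_{i,l}=\lambda_{l,i}^{-1}$ for all $1\le i,l\le N$, where $(\lambda_{i,l})\in M_N(\mathbb{K}^*)$; 3. for $2\le i\le N$ there is $q_i\in\mathbb{K}^*$, $q_i\ne 1$, with $\delta_i\circ\sigma_i=q_i\sigma_i\circ\delta_i$; 4. for $2\le i\le N$ the map $\delta_i$ extends to a locally nilpotent, iterative higher $q_i$-skew $\sigma_i$-derivation $\{d_{i,n}\}_{n\ge0}$ on $A_{i-1}$, and $\sigma_l\circ d_{i,n}=\lambda_{l,i}^n\,d_{i,n}\circ\sigma_l$ on $A_{i-1}$ for all $n\ge 0$ and $i+1\le l\le N$. **Deleting derivations.** Let $F=\mathrm{Frac}(A)$ be the division ring of fractions of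 $A$. Set $(X_1^{(N+1)},\dots,X_N^{(N+1)})=(X_1,\dots,X_N)$ and, recursively for $j=N,N-1,\dots,2$, writing $x_l=X_l^{(j+1)}$, define $y_l=X_l^{(j)}\in F$ by $$y_l=\begin{cases}x_l & l\ge j,\\ \sum_{n\ge0}q_j^{n(n+1)/2}(q_j-1)^{-n}\,d_{j,n}\circ\sigma_j^{-n}(x_l)\,x_j^{-n} & l<j,\end{cases}$$ where $\mathbb{K}\langle x_1,\dots,x_{j-1}\rangle$ is identified with $A_{j-1}$ through $x_i\leftrightarrow X_i$. Put $A^{(j)}=\mathbb{K}\langle X_1^{(j)},\dots,X_N^{(j)}\rangle\subseteq F$. **Hypothesis 2** (for a fixed $j\in\{2,\dots,N\}$). There are maps $\sigma_i^{(j+1)}$ for $j+1\le i\le N$ such that: 1. $A^{(j+1)}\cong\mathbb{K}[X_1]\cdots[X_j;\sigma_j,\delta_j][X_{j+1};\sigma_{j+1}^{(j+1)}]\cdots[X_N;\sigma_N^{(j+1)}]$ by an isomorphism sending $x_i$ to $X_i$ for all $i\in\{1,\dots,N\}$; 2. for each $i\in\{j+1,\dots,N\}$, the map $\sigma_i^{(j+1)}$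 is an automorphism with $\sigma_i^{(j+1)}(X_l)=\lambda_{i,l}X_l$ for all $l<i$, and $\sigma_i^{(j+1)}\circ d_{l,n}=\lambda_{i,l}^n\,d_{l,n}\circ\sigma_i^{(j+1)}$ on $A_{l-1}$ for all $l\in\{2,\dots,j\}$ and $n\ge0$. **Theorem 2.2.** Let $A$ satisfy Hypothesis 1, let $j\in\{2,\dots,N\}$, and suppose that $A^{(j+1)}$ satisfies Hypothesis 2. Then there are maps $\sigma_i^{(j)}$ for $j\le i\le N$ such that: (I) $A^{(j)}\cong\mathbb{K}[X_1][X_2;\sigma_2,\delta_2]\cdots[X_{j-1};\sigma_{j-1},\delta_{j-1}][X_j;\sigma_j^{(j)}]\cdots[X_N;\sigma_N^{(j)}]$ by an isomorphism which sends $y_l$ to $X_l$ for all $l\in\{1,\dots,N\}$. (II) For all $i\in\{j,\dots,N\}$ the map $\sigma_i^{(j)}$ is an automorphism satisfying (i) $\sigma_i^{(j)}(X_l)=\lambda_{i,l}X_l$ for all $l\in\{1,\dots,i-1\}$, and (ii) $\sigma_i^{(j)}\circ d_{l,n}=\lambda_{i,l}^n\,d_{l,n}\circ\sigma_i^{(j)}$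 on $A_{l-1}$ for all $n\ge0$ and all $l\in\{2,\dots,j-1\}$. (III) Let $S_j=\{x_j^n\mid n\ge0\}=\{y_j^n\mid n\ge0\}$. This is a multiplicatively closed set of regular elements satisfying the two-sided Ore condition in both $A^{(j+1)}$ and $A^{(j)}$, and $A^{(j)}S_j^{-1}=A^{(j+1)}S_j^{-1}$ inside $F$. -/

import Mathlib

/-! Indices are zero-based: the generators `X_1, …, X_N` are `X 0, …, X (N-1)`, indexed by `Fin N`.
For a family `x`, `genSubalg K x k` is the subalgebra generated by its first `k` members; for
`i : Fin N`, `genSubalg K x i` is generated by the members strictly before `x i`. -/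

/-- The subalgebra `K⟨x_l : l < k⟩` generated by the first `k` members of a family. -/
def genSubalg (K : Type*) [Field K] {B : Type*} [Ring B] [Algebra K B] {N : ℕ}
    (x : Fin N → B) (k : ℕ) : Subalgebra K B :=
  Algebra.adjoin K (x '' {l | (l : ℕ) < k})

theorem genSubalg_mono {K : Type*} [Field K] {B : Type*} [Ring B] [Algebra K B] {N : ℕ}
    (x : Fin N → B) {k m : ℕ} (h : k ≤ m) : genSubalg K x k ≤ genSubalg K x m :=
  Algebra.adjoin_mono (Set.image_mono fun _ hl => lt_of_lt_of_le hl h)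

theorem mem_genSubalg {K : Type*} [Field K] {B : Type*} [Ring B] [Algebra K B] {N : ℕ}
    (x : Fin N → B) {k : ℕ} {l : Fin N} (h : (l : ℕ) < k) : x l ∈ genSubalg K x k :=
  Algebra.subset_adjoin ⟨l, h, rfl⟩

/-- `S = R[x; σ, δ]`: the map `δ` is a (left) `σ`-derivation of `R`, the ring `S` contains `R` and
`x`, it is a free left `R`-module with basis `1, x, x², …`, and `x r = σ(r) x + δ(r)` for `r ∈ R`. -/
structure IsOreExtension {K : Type*} [Field K] {B : Type*} [Ring B] [Algebra K B]
    (R S : Subalgebra K B) (x : B) (σ : R ≃ₐ[K] R) (δ : R →ₗ[K] R) : Prop where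
  le : R ≤ S
  mem : x ∈ S
  derivation : ∀ a b : R, δ (a * b) = σ a * δ b + δ a * b
  comm : ∀ r : R, x * (r : B) = (σ r : B) * x + (δ r : B)
  basis : ∀ s ∈ S, ∃! p : ℕ →₀ R, (p.sum fun n r => (r : B) * x ^ n) = s

/-- The Gaussian binomial coefficient, a polynomial in `q`, evaluated at `q` (so it makes sense when
`q` is a root of unity). Defined through the `q`-Pascal rule. -/
def gaussBinom {K : Type*} [Field K] (q : K) : ℕ → ℕ → K
  | _, 0 => 1
  | 0, _ + 1 => 0
  | n + 1, k + 1 => gaussBinom q n k + q ^ (k + 1) * gaussBinom q n (k + 1)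

/-- `δ` extends to the higher `q`-skew `σ`-derivation `{d n}` on `R`. -/
structure IsHigherSkewDerivation {K : Type*} [Field K] {R : Type*} [Ring R] [Algebra K R]
    (q : K) (σ : R ≃ₐ[K] R) (δ : R →ₗ[K] R) (d : ℕ → R →ₗ[K] R) : Prop where
  zero : d 0 = LinearMap.id
  one : d 1 = δ
  leibniz : ∀ (n : ℕ) (r s : R),
    d n (r * s) = ∑ i ∈ Finset.range (n + 1), (⇑σ)^[n - i] (d i r) * d (n - i) s
  skew : ∀ (n : ℕ) (r : R), d n (σ r) = q ^ n • σ (d n r)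

/-- Every element is annihilated by all `d n` with `n` large. -/
def IsLocallyNilpotentSeq {K : Type*} [Field K] {R : Type*} [Ring R] [Algebra K R]
    (d : ℕ → R →ₗ[K] R) : Prop :=
  ∀ r : R, ∃ m : ℕ, ∀ n : ℕ, m ≤ n → d n r = 0

/-- `d_n d_m = binom(n+m, m)_q d_{n+m}`. -/
def IsIterativeSeq {K : Type*} [Field K] {R : Type*} [Ring R] [Algebra K R]
    (q : K) (d : ℕ → R →ₗ[K] R) : Prop :=
  ∀ (n m : ℕ) (r : R), d n (d m r) = gaussBinom q (n + m) m • d (n + m) r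

/-- A quantum nilpotent algebra `A = K[X_1][X_2; σ_2, δ_2]…[X_N; σ_N, δ_N]` with its higher skew
derivations `d i n`. The first step is written in the same way as the others: `σ 0` and `δ 0` act on
`genSubalg K X 0`, which is `K`, so they are the identity and zero. The values `q 0` and `d 0` carry
no condition and are never used. -/
structure QuantumNilpotentAlgebra (K : Type*) [Field K] (A : Type*) [Ring A] [Algebra K A]
    (N : ℕ) where
  X : Fin N → A
  σ : ∀ i : Fin N, genSubalg K X i ≃ₐ[K] genSubalg K X i
  δ : ∀ i : Fin N, genSubalg K X i →ₗ[K] genSubalg K X i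
  lam : Fin N → Fin N → Kˣ
  q : Fin N → Kˣ
  d : ∀ i : Fin N, ℕ → genSubalg K X i →ₗ[K] genSubalg K X i
  algebraMap_injective : Function.Injective (algebraMap K A)
  generates : genSubalg K X N = ⊤
  ore : ∀ i : Fin N,
    IsOreExtension (genSubalg K X i) (genSubalg K X (i + 1)) (X i) (σ i) (δ i)
  σ_gen : ∀ (i l : Fin N) (h : (l : ℕ) < i),
    (σ i ⟨X l, mem_genSubalg X h⟩ : A) = (lam i l : K) • X l
  lam_antisymm : ∀ i l : Fin N, lam i l = (lam l i)⁻¹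
  q_ne_one : ∀ i : Fin N, 0 < (i : ℕ) → q i ≠ 1
  skew : ∀ i : Fin N, 0 < (i : ℕ) → ∀ a, δ i (σ i a) = (q i : K) • σ i (δ i a)
  higher : ∀ i : Fin N, 0 < (i : ℕ) → IsHigherSkewDerivation (q i : K) (σ i) (δ i) (d i)
  locallyNilpotent : ∀ i : Fin N, 0 < (i : ℕ) → IsLocallyNilpotentSeq (d i)
  iterative : ∀ i : Fin N, 0 < (i : ℕ) → IsIterativeSeq (q i : K) (d i)
  /-- `σ_l ∘ d_{i,n} = λ_{l,i}^n d_{i,n} ∘ σ_l` on `A_{i-1}`; here `b` is `σ_l(a)`, an element of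
  `A_{i-1}` again. -/
  σ_comp_d : ∀ (i l : Fin N) (_ : 0 < (i : ℕ)) (h : (i : ℕ) < l) (n : ℕ)
    (a : genSubalg K X i), ∃ b : genSubalg K X i,
      (σ l (Subalgebra.inclusion (genSubalg_mono X h.le) a) : A) = b ∧
      (σ l (Subalgebra.inclusion (genSubalg_mono X h.le) (d i n a)) : A) =
        (lam l i : K) ^ n • (d i n b : A)

/-- `F` is, through `ι`, a division ring of fractions of `A`. -/
def IsDivisionRingOfFractions {K : Type*} [Field K] {A : Type*} [Ring A] [Algebra K A]
    {F : Type*} [DivisionRing F] [Algebra K F] (ι : A →ₐ[K] F) : Prop :=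
  Function.Injective ι ∧ ∀ f : F, ∃ a b : A, b ≠ 0 ∧ f = ι a * (ι b)⁻¹

namespace QuantumNilpotentAlgebra

variable {K : Type*} [Field K] {A : Type*} [Ring A] [Algebra K A] {N : ℕ}
  (Q : QuantumNilpotentAlgebra K A N) {F : Type*} [DivisionRing F] [Algebra K F]

open Classical in
/-- The algebra homomorphism from `K⟨X_l : l < k⟩` to `F` that sends `X_l` to `x_l` for all `l < k`
(there is at most one; the junk value is zero if there is none). Through it the elements of
`K⟨x_l : l < k⟩` are identified with those of `K⟨X_l : l < k⟩`. -/
noncomputable def identify (x : Fin N → F) (k : ℕ) (a : genSubalg K Q.X k) : F :=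
  if h : ∃ θ : genSubalg K Q.X k →ₐ[K] F,
      ∀ (l : Fin N) (hl : (l : ℕ) < k), θ ⟨Q.X l, mem_genSubalg Q.X hl⟩ = x l
  then h.choose a else 0

/-- The change of indeterminates that deletes `δ_j`: `y_l = x_l` for `l ≥ j` and
`y_l = ∑_n q_j^{n(n+1)/2} (q_j - 1)^{-n} d_{j,n}(σ_j^{-n}(x_l)) x_j^{-n}` for `l < j`. -/
noncomputable def deleteStep (j : Fin N) (x : Fin N → F) (l : Fin N) : F :=
  if h : (l : ℕ) < j then
    ∑ᶠ n : ℕ, ((Q.q j : K) ^ (n * (n + 1) / 2) * (((Q.q j : K) - 1)⁻¹) ^ n) •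
      (Q.identify x j (Q.d j n ((⇑(Q.σ j).symm)^[n] ⟨Q.X l, mem_genSubalg Q.X h⟩)) *
        (x j)⁻¹ ^ n)
  else x l

/-- The sequences of the deleting derivations algorithm. The last one is `(X_1, …, X_N)`, and the
step at `j : Fin N` leads from the sequence number `j.succ` to the sequence number `j.castSucc`. -/
noncomputable def gens (ι : A →ₐ[K] F) (k : Fin (N + 1)) : Fin N → F :=
  Fin.reverseInduction (motive := fun _ => Fin N → F)
    (fun l => ι (Q.X l)) (fun j x => Q.deleteStep j x) k

/-- `K⟨x_1, …, x_N⟩ = K[X_1]…[X_k; σ_k, δ_k][X_{k+1}; τ_{k+1}]…[X_N; τ_N]` with `x_l` corresponding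
to `X_l`: the isomorphism `θ` identifies `A_k = K[X_1]…[X_k; σ_k, δ_k]` with `K⟨x_1, …, x_k⟩`, and
each further `x_i` gives an Ore extension with automorphism `τ_i` and zero derivation. -/
structure IsPresentation (x : Fin N → F) (k : ℕ)
    (θ : genSubalg K Q.X k ≃ₐ[K] genSubalg K x k)
    (τ : ∀ i : Fin N, k ≤ (i : ℕ) → genSubalg K x i ≃ₐ[K] genSubalg K x i) : Prop where
  map_gen : ∀ (l : Fin N) (h : (l : ℕ) < k),
    (θ ⟨Q.X l, mem_genSubalg Q.X h⟩ : F) = x l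
  ore : ∀ (i : Fin N) (h : k ≤ (i : ℕ)),
    IsOreExtension (genSubalg K x i) (genSubalg K x (i + 1)) (x i) (τ i h) 0

/-- The automorphisms `τ_i` scale the generators, `τ_i(x_l) = λ_{i,l} x_l` for `l < i`, and
`τ_i ∘ d_{l,n} = λ_{i,l}^n d_{l,n} ∘ τ_i` on `K⟨x_m : m < l⟩` for every `l < k` but the first one.
The latter algebra is identified with `K⟨X_m : m < l⟩`, where `d_{l,n}` is defined, through `θ`;
the element `b` corresponds to `τ_i` applied to the element that `a` corresponds to. -/
structure IsCompatible (x : Fin N → F) (k : ℕ)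
    (θ : genSubalg K Q.X k ≃ₐ[K] genSubalg K x k)
    (τ : ∀ i : Fin N, k ≤ (i : ℕ) → genSubalg K x i ≃ₐ[K] genSubalg K x i) : Prop where
  scale : ∀ (i : Fin N) (h : k ≤ (i : ℕ)) (l : Fin N) (hl : (l : ℕ) < i),
    (τ i h ⟨x l, mem_genSubalg x hl⟩ : F) = (Q.lam i l : K) • x l
  comp_d : ∀ (i : Fin N) (h : k ≤ (i : ℕ)) (l : Fin N) (_ : 0 < (l : ℕ)) (hl : (l : ℕ) < k)
    (n : ℕ) (a : genSubalg K Q.X l), ∃ b : genSubalg K Q.X l,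
      (τ i h (Subalgebra.inclusion (genSubalg_mono x h)
          (θ (Subalgebra.inclusion (genSubalg_mono Q.X hl.le) a))) : F) =
        θ (Subalgebra.inclusion (genSubalg_mono Q.X hl.le) b) ∧
      (τ i h (Subalgebra.inclusion (genSubalg_mono x h)
          (θ (Subalgebra.inclusion (genSubalg_mono Q.X hl.le) (Q.d l n a)))) : F) =
        (Q.lam i l : K) ^ n • (θ (Subalgebra.inclusion (genSubalg_mono Q.X hl.le) (Q.d l n b)) : F)

end QuantumNilpotentAlgebra

/-- A multiplicatively closed set of regular elements with the two-sided Ore condition. -/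
structure IsRegularOreSet {R : Type*} [Ring R] (S : Submonoid R) : Prop where
  regular : ∀ s ∈ S, IsRegular s
  right_ore : ∀ (r : R), ∀ s ∈ S, ∃ (r' : R), ∃ s' ∈ S, r * s' = s * r'
  left_ore : ∀ (r : R), ∀ s ∈ S, ∃ (r' : R), ∃ s' ∈ S, s' * r = r' * s

/-- The set `R S⁻¹` of right fractions inside a division ring that contains `R`, where
`S = {s ^ n | n ≥ 0}`. -/
def rightFractions {K : Type*} [Field K] {F : Type*} [DivisionRing F] [Algebra K F]
    (R : Subalgebra K F) (s : F) : Set F :=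
  {f | ∃ r ∈ R, ∃ n : ℕ, f = r * (s ^ n)⁻¹}

/-! The idea, for one step of the algorithm. Let `R = K⟨X_l : l < j⟩`, embedded in `F` by `θ`, and write
`x = x_j`, `σ = σ_j`, `q = q_j`, `d_n = d_{j,n}`, so that `x r = σ(r) x + d_1(r)`. The new generators
are the values at the old ones of the deletion map `Φ(r) = ∑ c_n d_n(σ⁻ⁿ r) x⁻ⁿ` with
`c_n = q^{n(n+1)/2} (q-1)⁻ⁿ`.

* `x Φ(r) = Φ(σ r) x`: this comes down to `c_{n+1} (q^{n+1} - 1) = q^{n+1} c_n [n+1]_q`, because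
  `d_1 d_n = [n+1]_q d_{n+1}` (`IsDeletable.mul_deletionFun`).
* `Φ` is multiplicative: by the previous point `x⁻ⁿ Φ(s) = Φ(σ⁻ⁿ s) x⁻ⁿ`, so that `Φ(r) Φ(s)` expands
  into terms with coefficients `c_n c_m`, which match those of `Φ(r s)` by the Leibniz rule and
  `c_{n+m} = q^{nm} c_n c_m` (`IsDeletable.deletionFun_mul`). No factorials in `q` are inverted, so
  `q` may be a root of unity.
* `Φ(r) x^m` is, for large `m`, a polynomial in `x` with leading coefficient `r`. Hence `Φ` is
  injective and the powers of `x` are independent over its image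
  (`IsDeletable.deletionFun_indep`); and since `d_n` lowers the degree of nilpotency, `R` lies in the
  algebra generated by `Φ(R)` and `x⁻¹` (`IsDeletable.mem_of_deletionHom_mem`).

The automorphisms after the step are conjugations in `F`: for `i ≥ j`, conjugation by `x_i` multiplies
every `y_l` with `l < i` by `λ_{i,l}` (`IsPresentation.conj_deleteStep`), since for `i > j` the factor
`λ_{i,j}^n` from `d_n` cancels the one from `x⁻ⁿ`. It also commutes with `Φ`
(`IsPresentation.conj_deletionHom`), which transfers its compatibility with the `d_{l,n}`.

For the Ore condition, the elements that the powers of `x` move into a subalgebra `B` always form a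
subalgebra (`oreFractions`), so it has to be checked on generators only. The generators `y_l` commute
with `x` up to scalars, and the `x_l` with `l < j` are reached from the `Φ(r)` and `x⁻¹`. This shows
that old and new generators have the same localization at `x`, for each initial segment that contains
`x_j`. In particular the coefficients of a relation between the powers of `x_i` over
`K⟨y_l : l < i⟩` are moved into `K⟨x_l : l < i⟩` by a common power of `x`, where such relations are
trivial (`IsPresentation.gen_indep`). -/

/-! ### The coefficients of the deletion map -/

section Coefficients

variable {K : Type*} [Field K] (q : K)

/-- The coefficient `q^{n(n+1)/2} (q-1)^{-n}` of the deletion map. -/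
def deletionCoeff (n : ℕ) : K := q ^ (n * (n + 1) / 2) * ((q - 1)⁻¹) ^ n

theorem deletionCoeff_zero : deletionCoeff q 0 = 1 := by simp [deletionCoeff]

theorem deletionCoeff_add (n m : ℕ) :
    deletionCoeff q (n + m) = q ^ (n * m) * (deletionCoeff q n * deletionCoeff q m) := by
  have h : (n + m) * (n + m + 1) / 2 = n * m + (n * (n + 1) / 2 + m * (m + 1) / 2) := by
    obtain ⟨a, ha⟩ := (Nat.even_mul_succ_self n).two_dvd
    obtain ⟨b, hb⟩ := (Nat.even_mul_succ_self m).two_dvd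
    have : (n + m) * (n + m + 1) = 2 * (n * m + (a + b)) := by
      linear_combination ha + hb
    rw [this, ha, hb]
    simp
  simp only [deletionCoeff, h, pow_add]
  ring

theorem gaussBinom_eq_zero : ∀ (n k : ℕ), n < k → gaussBinom q n k = 0
  | _, 0, h => absurd h (Nat.not_lt_zero _)
  | 0, _ + 1, _ => by simp [gaussBinom]
  | n + 1, k + 1, h => by
    rw [gaussBinom, gaussBinom_eq_zero n k (by omega), gaussBinom_eq_zero n (k + 1) (by omega)]
    simp

theorem gaussBinom_self (n : ℕ) : gaussBinom q n n = 1 := by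
  induction n with
  | zero => simp [gaussBinom]
  | succ n ih => rw [gaussBinom, ih, gaussBinom_eq_zero q n (n + 1) (by omega)]; simp

theorem gaussBinom_succ_self (n : ℕ) : (q - 1) * gaussBinom q (n + 1) n = q ^ (n + 1) - 1 := by
  induction n with
  | zero => simp [gaussBinom]
  | succ n ih =>
    rw [gaussBinom, gaussBinom_self, mul_add, ih]
    ring

theorem deletionCoeff_succ {q : K} (h : q ≠ 1) (n : ℕ) :
    deletionCoeff q (n + 1) * (q ^ (n + 1) - 1) =
      q ^ (n + 1) * (deletionCoeff q n * gaussBinom q (n + 1) n) := by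
  have h1 : q - 1 ≠ 0 := sub_ne_zero.mpr h
  have h2 : deletionCoeff q 1 = q * (q - 1)⁻¹ := by simp [deletionCoeff]
  rw [deletionCoeff_add, h2, ← gaussBinom_succ_self]
  field_simp
  ring

end Coefficients

/-! ### The deletion map -/

/-- The setting of one deletion step: `R` is embedded by `φ` in a division ring, where `x` satisfies
the relation `x r = σ(r) x + δ(r)` of the Ore extension `R[x; σ, δ]` and has left `R`-independent
powers, and `δ = d 1` extends to a locally nilpotent iterative higher `q`-skew `σ`-derivation. -/
structure IsDeletable {K : Type*} [Field K] {R : Type*} [Ring R] [Algebra K R]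
    {F : Type*} [DivisionRing F] [Algebra K F] (q : K) (σ : R ≃ₐ[K] R) (δ : R →ₗ[K] R)
    (d : ℕ → R →ₗ[K] R) (φ : R →ₐ[K] F) (x : F) : Prop where
  q_ne_zero : q ≠ 0
  q_ne_one : q ≠ 1
  higher : IsHigherSkewDerivation q σ δ d
  locallyNilpotent : IsLocallyNilpotentSeq d
  iterative : IsIterativeSeq q d
  ne_zero : x ≠ 0
  comm : ∀ r, x * φ r = φ (σ r) * x + φ (δ r)
  indep : ∀ (T : ℕ) (r : ℕ → R), ∑ n ∈ Finset.range T, φ (r n) * x ^ n = 0 → ∀ n < T, r n = 0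

/-- The deletion map `r ↦ ∑ₙ q^{n(n+1)/2} (q-1)^{-n} dₙ(σ⁻ⁿ(r)) x⁻ⁿ`, where `R` is identified with its
image under `φ`. -/
noncomputable def deletionFun {K : Type*} [Field K] {R : Type*} [Ring R] [Algebra K R]
    {F : Type*} [DivisionRing F] [Algebra K F] (q : K) (σ : R ≃ₐ[K] R)
    (d : ℕ → R →ₗ[K] R) (φ : R →ₐ[K] F) (x : F) (r : R) : F :=
  ∑ᶠ n : ℕ, deletionCoeff q n • (φ (d n ((⇑σ.symm)^[n] r)) * x⁻¹ ^ n)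

namespace IsDeletable

variable {K : Type*} [Field K] {R : Type*} [Ring R] [Algebra K R]
  {F : Type*} [DivisionRing F] [Algebra K F] {q : K} {σ : R ≃ₐ[K] R} {δ : R →ₗ[K] R}
  {d : ℕ → R →ₗ[K] R} {φ : R →ₐ[K] F} {x : F} (H : IsDeletable q σ δ d φ x)

include H

theorem d_iterate (n k : ℕ) (r : R) : d n ((⇑σ)^[k] r) = q ^ (n * k) • (⇑σ)^[k] (d n r) := by
  induction k with
  | zero => simp
  | succ k ih =>
    rw [Function.iterate_succ_apply', H.higher.skew, ih, map_smul, smul_smul,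
      Function.iterate_succ_apply']
    congr 1
    ring

theorem d_symm_iterate_eq_zero {n : ℕ} {r : R} (h : d n r = 0) (k : ℕ) :
    d n ((⇑σ.symm)^[k] r) = 0 := by
  have hr : (⇑σ)^[k] ((⇑σ.symm)^[k] r) = r := Function.LeftInverse.iterate σ.apply_symm_apply k r
  rw [← hr, H.d_iterate, smul_eq_zero] at h
  have h0 : (⇑σ)^[k] (d n ((⇑σ.symm)^[k] r)) = (⇑σ)^[k] 0 := by
    rw [h.resolve_left (pow_ne_zero _ H.q_ne_zero), Function.iterate_fixed (map_zero σ)]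
  exact σ.injective.iterate k h0

/-- The sum that defines the deletion map may be truncated anywhere beyond the nilpotency degree. -/
theorem deletionFun_eq_sum {r : R} {m : ℕ} (h : ∀ n, m ≤ n → d n r = 0) :
    deletionFun q σ d φ x r = ∑ n ∈ Finset.range m,
      deletionCoeff q n • (φ (d n ((⇑σ.symm)^[n] r)) * x⁻¹ ^ n) := by
  refine finsum_eq_sum_of_support_subset _ fun n hn => ?_
  by_contra hm
  refine hn ?_
  simp only [Finset.coe_range, Set.mem_Iio, not_lt] at hm
  simp [H.d_symm_iterate_eq_zero (h n hm)]

/-- The deletion map as a linear map. -/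
noncomputable def deletionLin : R →ₗ[K] F where
  toFun := deletionFun q σ d φ x
  map_add' r s := by
    obtain ⟨m, hm⟩ := H.locallyNilpotent r
    obtain ⟨m', hm'⟩ := H.locallyNilpotent s
    have h1 : ∀ n, max m m' ≤ n → d n r = 0 := fun n hn => hm n (le_of_max_le_left hn)
    have h2 : ∀ n, max m m' ≤ n → d n s = 0 := fun n hn => hm' n (le_of_max_le_right hn)
    rw [H.deletionFun_eq_sum h1, H.deletionFun_eq_sum h2,
      H.deletionFun_eq_sum (m := max m m') fun n hn => by rw [map_add, h1 n hn, h2 n hn, add_zero],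
      ← Finset.sum_add_distrib]
    refine Finset.sum_congr rfl fun n _ => ?_
    rw [iterate_map_add, map_add, map_add, add_mul, smul_add]
  map_smul' c r := by
    obtain ⟨m, hm⟩ := H.locallyNilpotent r
    rw [H.deletionFun_eq_sum hm,
      H.deletionFun_eq_sum (m := m) fun n hn => by rw [map_smul, hm n hn, smul_zero],
      Finset.smul_sum]
    refine Finset.sum_congr rfl fun n _ => ?_
    have : (⇑σ.symm)^[n] (c • r) = c • (⇑σ.symm)^[n] r :=
      (Function.Semiconj.iterate_right (f := fun r => c • r) (fun r => (map_smul σ.symm c r).symm)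
        n r).symm
    simp only [this, map_smul, smul_mul_assoc, RingHom.id_apply]
    rw [smul_comm]

theorem d_one_comp (n : ℕ) (r : R) : δ (d n r) = gaussBinom q (n + 1) n • d (n + 1) r := by
  rw [← H.higher.one, H.iterative, add_comm]

/-- The element `x`, which acts on `R` through a skew derivation, commutes with the image of the
deletion map up to `σ`: the derivation has been deleted. -/
theorem mul_deletionFun (r : R) :
    x * deletionFun q σ d φ x r = deletionFun q σ d φ x (σ r) * x := by
  obtain ⟨m, hm⟩ := H.locallyNilpotent r
  have hs : ∀ n, m ≤ n → d n (σ r) = 0 := fun n hn => by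
    rw [H.higher.skew, hm n hn, map_zero, smul_zero]
  have hx := H.ne_zero
  have hsymm (n : ℕ) : (⇑σ.symm)^[n] (σ r) = σ ((⇑σ.symm)^[n] r) :=
    (Function.Commute.iterate_left (fun a => by simp : Function.Commute σ.symm σ) n r)
  have hsucc (n : ℕ) : (⇑σ.symm)^[n + 1] (σ r) = (⇑σ.symm)^[n] r := by
    rw [Function.iterate_succ_apply, σ.symm_apply_apply]
  have hskew (n : ℕ) : σ (d n ((⇑σ.symm)^[n] r)) =
      (q ^ n)⁻¹ • d n ((⇑σ.symm)^[n] (σ r)) := by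
    rw [hsymm, H.higher.skew, inv_smul_smul₀ (pow_ne_zero _ H.q_ne_zero)]
  have hterm (n : ℕ) :
      x * (deletionCoeff q n • (φ (d n ((⇑σ.symm)^[n] r)) * x⁻¹ ^ n)) =
        (deletionCoeff q n * (q ^ n)⁻¹) • (φ (d n ((⇑σ.symm)^[n] (σ r))) * x⁻¹ ^ n * x) +
        (deletionCoeff q n * gaussBinom q (n + 1) n) •
          (φ (d (n + 1) ((⇑σ.symm)^[n] r)) * x⁻¹ ^ n) := by
    have hcx : x * x⁻¹ ^ n = x⁻¹ ^ n * x :=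
      ((Commute.refl x).inv_right₀.pow_right n).eq
    rw [mul_smul_comm, ← mul_assoc, H.comm, add_mul, mul_assoc _ x, hcx, hskew, H.d_one_comp,
      smul_add, map_smul, map_smul, smul_mul_assoc, smul_mul_assoc, smul_smul, smul_smul,
      ← mul_assoc]
  -- By this identity the two parts of `hterm`, shifted against each other, telescope.
  have hcoeff (n : ℕ) : deletionCoeff q n * gaussBinom q (n + 1) n =
      deletionCoeff q (n + 1) - deletionCoeff q (n + 1) * (q ^ (n + 1))⁻¹ := by
    have h := deletionCoeff_succ H.q_ne_one n
    have h0 := pow_ne_zero (n + 1) H.q_ne_zero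
    field_simp
    linear_combination -h
  rw [H.deletionFun_eq_sum (m := m + 1) fun n hn => hm n (by omega),
    H.deletionFun_eq_sum (m := m + 1) fun n hn => hs n (by omega), Finset.mul_sum,
    Finset.sum_mul, Finset.sum_congr rfl fun n _ => hterm n, Finset.sum_add_distrib,
    Finset.sum_range_succ (fun n => (deletionCoeff q n * gaussBinom q (n + 1) n) • _),
    H.d_symm_iterate_eq_zero (hm (m + 1) (by omega)), map_zero, zero_mul, smul_zero, add_zero,
    Finset.sum_range_succ', Finset.sum_range_succ' _ m, add_right_comm, ← Finset.sum_add_distrib]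
  congr 1
  · refine Finset.sum_congr rfl fun n _ => ?_
    rw [hcoeff, hsucc]
    have : x⁻¹ ^ (n + 1) * x = x⁻¹ ^ n := by
      rw [pow_succ, mul_assoc, inv_mul_cancel₀ hx, mul_one]
    rw [mul_assoc, this, ← add_smul, smul_mul_assoc, mul_assoc, this]
    congr 1
    ring
  · simp

theorem inv_mul_deletionFun (r : R) :
    x⁻¹ * deletionFun q σ d φ x r = deletionFun q σ d φ x (σ.symm r) * x⁻¹ := by
  have h := H.mul_deletionFun (σ.symm r)
  rw [σ.apply_symm_apply] at h
  rw [eq_mul_inv_iff_mul_eq₀ H.ne_zero, mul_assoc, ← h, inv_mul_cancel_left₀ H.ne_zero]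

theorem inv_pow_mul_deletionFun (n : ℕ) (r : R) :
    x⁻¹ ^ n * deletionFun q σ d φ x r = deletionFun q σ d φ x ((⇑σ.symm)^[n] r) * x⁻¹ ^ n := by
  induction n with
  | zero => simp
  | succ n ih =>
    rw [pow_succ', mul_assoc, ih, ← mul_assoc, H.inv_mul_deletionFun, mul_assoc,
      Function.iterate_succ_apply']

theorem pow_mul_deletionFun (n : ℕ) (r : R) :
    x ^ n * deletionFun q σ d φ x r = deletionFun q σ d φ x ((⇑σ)^[n] r) * x ^ n := by
  induction n with
  | zero => simp
  | succ n ih =>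
    rw [pow_succ', mul_assoc, ih, ← mul_assoc, H.mul_deletionFun, mul_assoc,
      Function.iterate_succ_apply']

/-- The deletion map is multiplicative. Both sides expand into the same terms, indexed by pairs
`(n, m)`, since `c_{n+m} = q^{nm} c_n c_m`. -/
theorem deletionFun_mul (r s : R) :
    deletionFun q σ d φ x (r * s) = deletionFun q σ d φ x r * deletionFun q σ d φ x s := by
  obtain ⟨a, ha⟩ := H.locallyNilpotent r
  obtain ⟨b, hb⟩ := H.locallyNilpotent s
  obtain ⟨e, he⟩ := H.locallyNilpotent (r * s)
  let t : ℕ × ℕ → F := fun p => (deletionCoeff q p.1 * deletionCoeff q p.2) •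
    (φ (d p.1 ((⇑σ.symm)^[p.1] r)) * φ (d p.2 ((⇑σ.symm)^[p.1 + p.2] s)) * x⁻¹ ^ (p.1 + p.2))
  have ht : ∀ p : ℕ × ℕ, p ∉ Finset.range a ×ˢ Finset.range b → t p = 0 := by
    intro p hp
    simp only [Finset.mem_product, Finset.mem_range, not_and_or, not_lt] at hp
    rcases hp with hp | hp
    · simp [t, H.d_symm_iterate_eq_zero (ha _ hp)]
    · simp [t, H.d_symm_iterate_eq_zero (hb _ hp)]
  have hleft : deletionFun q σ d φ x r * deletionFun q σ d φ x s =
      ∑ p ∈ Finset.range a ×ˢ Finset.range b, t p := by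
    rw [Finset.sum_product, H.deletionFun_eq_sum ha, Finset.sum_mul]
    refine Finset.sum_congr rfl fun n _ => ?_
    -- Moving `x⁻ⁿ` across the second factor costs only `σ⁻ⁿ`.
    rw [smul_mul_assoc, mul_assoc, H.inv_pow_mul_deletionFun,
      H.deletionFun_eq_sum (fun k hk => H.d_symm_iterate_eq_zero (hb k hk) n), Finset.sum_mul,
      Finset.mul_sum, Finset.smul_sum]
    refine Finset.sum_congr rfl fun k _ => ?_
    simp only [t, smul_mul_assoc, mul_smul_comm, smul_smul, mul_assoc]
    rw [← Function.iterate_add_apply, add_comm k n, ← pow_add, add_comm k n]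
  have hright (n : ℕ) : deletionCoeff q n • (φ (d n ((⇑σ.symm)^[n] (r * s))) * x⁻¹ ^ n) =
      ∑ p ∈ Finset.HasAntidiagonal.antidiagonal n, t p := by
    rw [Finset.Nat.sum_antidiagonal_eq_sum_range_succ_mk, iterate_map_mul, H.higher.leibniz,
      map_sum, Finset.sum_mul, Finset.smul_sum]
    refine Finset.sum_congr rfl fun i hi => ?_
    obtain ⟨k, rfl⟩ := Nat.exists_eq_add_of_le (Nat.lt_succ_iff.mp (Finset.mem_range.mp hi))
    have h1 : (⇑σ)^[k] ((⇑σ.symm)^[i + k] r) = (⇑σ.symm)^[i] r := by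
      rw [add_comm, Function.iterate_add_apply]
      exact Function.LeftInverse.iterate σ.apply_symm_apply k _
    have h2 : (⇑σ)^[k] (d i ((⇑σ.symm)^[i + k] r)) =
        (q ^ (i * k))⁻¹ • d i ((⇑σ.symm)^[i] r) := by
      rw [← h1, H.d_iterate, inv_smul_smul₀ (pow_ne_zero _ H.q_ne_zero)]
    simp only [t, Nat.add_sub_cancel_left, h2, map_mul, map_smul, smul_mul_assoc, smul_smul]
    congr 1
    rw [deletionCoeff_add]
    field_simp [H.q_ne_zero]
  have hmaps : ∀ p ∈ Finset.range a ×ˢ Finset.range b,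
      p.1 + p.2 ∈ Finset.range (max e (a + b)) := by
    intro p hp
    simp only [Finset.mem_product, Finset.mem_range] at hp ⊢
    omega
  rw [hleft, H.deletionFun_eq_sum (m := max e (a + b)) fun n hn => he n (le_of_max_le_left hn),
    ← Finset.sum_fiberwise_of_maps_to hmaps]
  refine Finset.sum_congr rfl fun n _ => ?_
  rw [hright]
  refine (Finset.sum_subset (fun p hp => ?_) fun p hp hp' => ht p fun h => hp' ?_).symm
  · exact Finset.HasAntidiagonal.mem_antidiagonal.mpr (Finset.mem_filter.mp hp).2
  · exact Finset.mem_filter.mpr ⟨h, Finset.HasAntidiagonal.mem_antidiagonal.mp hp⟩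

/-! ### Leading coefficients, injectivity and independence -/

/-- The elements `∑_{n < T} r_n x^n`: left polynomials in `x` of degree less than `T`. -/
def polyLT (φ : R →ₐ[K] F) (x : F) (T : ℕ) : Submodule K F where
  carrier := {f | ∃ r : ℕ → R, f = ∑ n ∈ Finset.range T, φ (r n) * x ^ n}
  add_mem' := by
    rintro _ _ ⟨r, rfl⟩ ⟨s, rfl⟩
    exact ⟨r + s, by simp [add_mul, Finset.sum_add_distrib]⟩
  zero_mem' := ⟨0, by simp⟩
  smul_mem' := by
    rintro c _ ⟨r, rfl⟩
    exact ⟨c • r, by simp [Finset.smul_sum]⟩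

omit H in
theorem monomial_mem_polyLT (r : R) {n T : ℕ} (h : n < T) : φ r * x ^ n ∈ polyLT φ x T := by
  classical
  refine ⟨Pi.single n r, ?_⟩
  rw [Finset.sum_eq_single_of_mem n (Finset.mem_range.mpr h)]
  · simp
  · intro m _ hm
    simp [Pi.single_eq_of_ne hm]

omit H in
theorem mul_pow_mem_polyLT {f : F} {S T k : ℕ} (hf : f ∈ polyLT φ x S) (h : S + k ≤ T) :
    f * x ^ k ∈ polyLT φ x T := by
  obtain ⟨r, rfl⟩ := hf
  rw [Finset.sum_mul]
  refine sum_mem fun n hn => ?_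
  rw [mul_assoc, ← pow_add]
  have := Finset.mem_range.mp hn
  exact monomial_mem_polyLT _ (by omega)

theorem eq_zero_of_mem_polyLT {r : R} {T : ℕ} (h : φ r * x ^ T ∈ polyLT φ x T) : r = 0 := by
  obtain ⟨s, hs⟩ := h
  have := H.indep (T + 1) (fun n => if n = T then r else -s n) (by
    rw [Finset.sum_range_succ, if_pos rfl, hs, ← Finset.sum_add_distrib]
    refine Finset.sum_eq_zero fun n hn => ?_
    simp [(Finset.mem_range.mp hn).ne]) T (Nat.lt_succ_self T)
  simpa using this

/-- After multiplication by a large power of `x`, the value of the deletion map at `r` is a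
polynomial in `x` with leading coefficient `r`. -/
theorem deletionFun_mul_pow_sub_mem {r : R} {m : ℕ} (h : ∀ n, m ≤ n → d n r = 0) :
    deletionFun q σ d φ x r * x ^ m - φ r * x ^ m ∈ polyLT φ x m := by
  rw [H.deletionFun_eq_sum (m := m + 1) fun n hn => h n (by omega), Finset.sum_range_succ',
    add_mul, Finset.sum_mul]
  simp only [deletionCoeff_zero, Function.iterate_zero, id, H.higher.zero, LinearMap.id_apply,
    pow_zero, mul_one, one_smul, add_sub_cancel_right]
  refine sum_mem fun n hn => ?_
  obtain ⟨k, rfl⟩ := Nat.exists_eq_add_of_lt (Finset.mem_range.mp hn)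
  have : x⁻¹ ^ (n + 1) * x ^ (n + k + 1) = x ^ k := by
    rw [show n + k + 1 = n + 1 + k by ring, pow_add x, inv_pow,
      inv_mul_cancel_left₀ (pow_ne_zero _ H.ne_zero)]
  rw [smul_mul_assoc, mul_assoc, this]
  exact Submodule.smul_mem _ _ (monomial_mem_polyLT _ (by omega))

/-- The powers of `x` stay independent over the image of the deletion map. -/
theorem deletionFun_indep (T : ℕ) (r : ℕ → R)
    (h : ∑ n ∈ Finset.range T, deletionFun q σ d φ x (r n) * x ^ n = 0) : ∀ n < T, r n = 0 := by
  induction T with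
  | zero => intro n hn; omega
  | succ T ih =>
    choose m hm using fun n => H.locallyNilpotent (r n)
    let L := (Finset.range (T + 1)).sup m
    have hL : ∀ n < T + 1, ∀ k, L ≤ k → d k (r n) = 0 := fun n hn k hk =>
      hm n k ((Finset.le_sup (f := m) (Finset.mem_range.mpr hn)).trans hk)
    have htop : r T = 0 := by
      refine H.eq_zero_of_mem_polyLT (T := L + T) ?_
      have h1 : φ (r T) * x ^ (L + T) =
          -((deletionFun q σ d φ x (r T) * x ^ L - φ (r T) * x ^ L) * x ^ T) -
          ∑ n ∈ Finset.range T, deletionFun q σ d φ x (r n) * x ^ L * x ^ n := by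
        have h2 := congrArg (· * x ^ L) h
        simp only [zero_mul, Finset.sum_range_succ, add_mul, Finset.sum_mul] at h2
        simp only [sub_mul, mul_assoc, ← pow_add] at h2 ⊢
        simp only [add_comm L]
        rw [← sub_eq_zero, ← h2]
        abel
      rw [h1]
      refine sub_mem (neg_mem (mul_pow_mem_polyLT
        (H.deletionFun_mul_pow_sub_mem (hL T (by omega))) le_rfl)) (sum_mem fun n hn => ?_)
      have hn := Finset.mem_range.mp hn
      rw [← sub_add_cancel (deletionFun q σ d φ x (r n) * x ^ L) (φ (r n) * x ^ L), add_mul]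
      refine add_mem (mul_pow_mem_polyLT
        (H.deletionFun_mul_pow_sub_mem (hL n (by omega))) (by omega)) ?_
      rw [mul_assoc, ← pow_add]
      exact monomial_mem_polyLT _ (by omega)
    have hzero : deletionFun q σ d φ x 0 = 0 := H.deletionLin.map_zero
    rw [Finset.sum_range_succ, htop, hzero, zero_mul, add_zero] at h
    intro n hn
    rcases Nat.lt_succ_iff_lt_or_eq.mp hn with hn | rfl
    · exact ih h n hn
    · exact htop

theorem eq_zero_of_deletionFun_eq_zero {r : R} (h : deletionFun q σ d φ x r = 0) : r = 0 :=
  H.deletionFun_indep 1 (fun _ => r) (by simp [h]) 0 one_pos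

theorem deletionFun_one : deletionFun q σ d φ x 1 = 1 := by
  -- The value is an idempotent of a division ring, and it does not vanish.
  have h := H.deletionFun_mul 1 1
  rw [mul_one] at h
  refine (mul_eq_left₀ fun h0 => ?_).mp h.symm
  have h1 : φ 1 = 0 := by rw [H.eq_zero_of_deletionFun_eq_zero h0, map_zero]
  exact one_ne_zero ((map_one φ).symm.trans h1)

/-- The deletion map as an algebra homomorphism. -/
noncomputable def deletionHom : R →ₐ[K] F :=
  AlgHom.ofLinearMap H.deletionLin H.deletionFun_one H.deletionFun_mul

theorem deletionHom_apply (r : R) : H.deletionHom r = deletionFun q σ d φ x r := rfl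

theorem deletionHom_injective : Function.Injective H.deletionHom :=
  (injective_iff_map_eq_zero _).mpr fun _ h => H.eq_zero_of_deletionFun_eq_zero h

/-- The deletion map is unipotent with respect to the nilpotency degree, so that `R` is recovered
from its image and `x⁻¹`. -/
theorem mem_of_deletionHom_mem {B : Subalgebra K F} (h : ∀ r, H.deletionHom r ∈ B)
    (hx : x⁻¹ ∈ B) (r : R) : φ r ∈ B := by
  have key (m : ℕ) : ∀ r, (∀ n, m ≤ n → d n r = 0) → φ r ∈ B := by
    induction m using Nat.strong_induction_on with
    | _ m ih =>
      intro r hr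
      have h1 := h r
      rw [deletionHom_apply, H.deletionFun_eq_sum (m := m + 1) fun n hn => hr n (by omega),
        Finset.sum_range_succ'] at h1
      simp only [deletionCoeff_zero, Function.iterate_zero, id, H.higher.zero,
        LinearMap.id_apply, pow_zero, mul_one, one_smul] at h1
      refine (add_mem_cancel_left (sum_mem fun n hn => ?_)).mp h1
      refine B.smul_mem (mul_mem ?_ (pow_mem hx _)) _
      have hn := Finset.mem_range.mp hn
      refine ih (m - (n + 1)) (by omega) _ fun k hk => ?_
      rw [H.iterative, H.d_symm_iterate_eq_zero (hr _ (by omega)), smul_zero]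
  obtain ⟨m, hm⟩ := H.locallyNilpotent r
  exact key m r hm

end IsDeletable

/-! ### Ore localization inside a division ring -/

section Fractions

variable {K : Type*} [Field K] {F : Type*} [DivisionRing F] [Algebra K F]

theorem pow_mul_of_mul_eq_smul {x g : F} {c : K} (h : x * g = c • (g * x)) (n : ℕ) :
    x ^ n * g = c ^ n • (g * x ^ n) := by
  induction n with
  | zero => simp
  | succ n ih =>
    rw [pow_succ', mul_assoc, ih, mul_smul_comm, ← mul_assoc, h, smul_mul_assoc, smul_smul,
      mul_assoc, ← pow_succ', ← pow_succ]

theorem pow_mul_pow_of_mul_eq_smul {x g : F} {c : K} (h : x * g = c • (g * x)) (n m : ℕ) :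
    x ^ n * g ^ m = c ^ (n * m) • (g ^ m * x ^ n) := by
  induction m with
  | zero => simp
  | succ m ih =>
    rw [pow_succ, ← mul_assoc, ih, smul_mul_assoc, mul_assoc, pow_mul_of_mul_eq_smul h,
      mul_smul_comm, smul_smul, mul_assoc, ← pow_add, mul_add_one]

/-- The elements of a division ring that the powers of `x` move into `B` from either side, as in the
two-sided Ore condition. They always form a subalgebra, and if it contains `B`, then the powers of `x`
are an Ore set in `B` and this subalgebra is the localization of `B` at `x`. -/
def oreFractions (B : Subalgebra K F) {x : F} (hx : x ≠ 0) (hxB : x ∈ B) : Subalgebra K F where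
  carrier := {a | (∀ n, ∃ m, x⁻¹ ^ n * a * x ^ m ∈ B) ∧ ∀ n, ∃ m, x ^ m * a * x⁻¹ ^ n ∈ B}
  add_mem' := by
    rintro a b ⟨ha, ha'⟩ ⟨hb, hb'⟩
    refine ⟨fun n => ?_, fun n => ?_⟩
    · obtain ⟨m, hm⟩ := ha n
      obtain ⟨k, hk⟩ := hb n
      refine ⟨m + k, ?_⟩
      have h : x⁻¹ ^ n * (a + b) * x ^ (m + k) =
          x⁻¹ ^ n * a * x ^ m * x ^ k + x⁻¹ ^ n * b * x ^ k * x ^ m := by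
        rw [mul_assoc _ (x ^ m), mul_assoc _ (x ^ k), ← pow_add, ← pow_add, add_comm k m, mul_add,
          add_mul]
      rw [h]
      exact add_mem (mul_mem hm (pow_mem hxB k)) (mul_mem hk (pow_mem hxB m))
    · obtain ⟨m, hm⟩ := ha' n
      obtain ⟨k, hk⟩ := hb' n
      refine ⟨m + k, ?_⟩
      have h : x ^ (m + k) * (a + b) * x⁻¹ ^ n =
          x ^ k * (x ^ m * a * x⁻¹ ^ n) + x ^ m * (x ^ k * b * x⁻¹ ^ n) := by
        simp only [← mul_assoc, ← pow_add]
        rw [add_comm k m, mul_add, add_mul]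
      rw [h]
      exact add_mem (mul_mem (pow_mem hxB k) hm) (mul_mem (pow_mem hxB m) hk)
  mul_mem' := by
    rintro a b ⟨ha, ha'⟩ ⟨hb, hb'⟩
    have hinv (k : ℕ) : x ^ k * x⁻¹ ^ k = 1 := by
      rw [inv_pow, mul_inv_cancel₀ (pow_ne_zero k hx)]
    have hinv' (k : ℕ) : x⁻¹ ^ k * x ^ k = 1 := by
      rw [inv_pow, inv_mul_cancel₀ (pow_ne_zero k hx)]
    refine ⟨fun n => ?_, fun n => ?_⟩
    · obtain ⟨k, hk⟩ := ha n
      obtain ⟨m, hm⟩ := hb k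
      refine ⟨m, ?_⟩
      have h : x⁻¹ ^ n * (a * b) * x ^ m = x⁻¹ ^ n * a * x ^ k * (x⁻¹ ^ k * b * x ^ m) := by
        simp only [mul_assoc]
        rw [← mul_assoc (x ^ k), hinv, one_mul]
      rw [h]
      exact mul_mem hk hm
    · obtain ⟨k, hk⟩ := hb' n
      obtain ⟨m, hm⟩ := ha' k
      refine ⟨m, ?_⟩
      have h : x ^ m * (a * b) * x⁻¹ ^ n = x ^ m * a * x⁻¹ ^ k * (x ^ k * b * x⁻¹ ^ n) := by
        simp only [mul_assoc]
        rw [← mul_assoc (x⁻¹ ^ k), hinv', one_mul]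
      rw [h]
      exact mul_mem hm hk
  algebraMap_mem' c := by
    refine ⟨fun n => ⟨n, ?_⟩, fun n => ⟨n, ?_⟩⟩
    · rw [← Algebra.commutes, mul_assoc, inv_pow, inv_mul_cancel₀ (pow_ne_zero n hx), mul_one]
      exact B.algebraMap_mem c
    · rw [← Algebra.commutes, mul_assoc, inv_pow, mul_inv_cancel₀ (pow_ne_zero n hx), mul_one]
      exact B.algebraMap_mem c

variable {B : Subalgebra K F} {x : F} (hx : x ≠ 0) (hxB : x ∈ B)

theorem inv_mem_oreFractions : x⁻¹ ∈ oreFractions B hx hxB := by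
  refine ⟨fun n => ⟨n + 1, ?_⟩, fun n => ⟨n + 1, ?_⟩⟩
  · rw [← pow_succ, inv_pow, inv_mul_cancel₀ (pow_ne_zero _ hx)]
    exact one_mem B
  · rw [mul_assoc, ← pow_succ', inv_pow, mul_inv_cancel₀ (pow_ne_zero _ hx)]
    exact one_mem B

/-- An element of `B` that commutes with `x` up to a scalar satisfies the Ore condition. -/
theorem mem_oreFractions_of_conj {g : F} (hg : g ∈ B) {c : Kˣ} (h : x * g = (c : K) • (g * x)) :
    g ∈ oreFractions B hx hxB := by
  have h1 := pow_mul_of_mul_eq_smul h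
  have hn (n : ℕ) : x ^ n ≠ 0 := pow_ne_zero n hx
  refine ⟨fun n => ⟨n, ?_⟩, fun n => ⟨n, ?_⟩⟩
  · have h2 : g * x ^ n = ((c : K) ^ n)⁻¹ • (x ^ n * g) := by
      rw [h1, inv_smul_smul₀ (pow_ne_zero n c.ne_zero)]
    rw [mul_assoc, h2, mul_smul_comm, inv_pow, inv_mul_cancel_left₀ (hn n)]
    exact B.smul_mem hg _
  · rw [h1, smul_mul_assoc, mul_assoc, inv_pow, mul_inv_cancel₀ (hn n), mul_one]
    exact B.smul_mem hg _

theorem exists_mul_pow_mem {a : F} (ha : a ∈ oreFractions B hx hxB) : ∃ m, a * x ^ m ∈ B := by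
  simpa using ha.1 0

include hx in
theorem mem_of_mul_pow_mem {C : Subalgebra K F} (hC : x⁻¹ ∈ C) {a : F} {m : ℕ}
    (h : a * x ^ m ∈ C) : a ∈ C := by
  have := mul_mem h (pow_mem hC m)
  rwa [mul_assoc, inv_pow, mul_inv_cancel₀ (pow_ne_zero m hx), mul_one] at this

theorem rightFractions_eq_oreFractions (h : B ≤ oreFractions B hx hxB) :
    rightFractions B x = oreFractions B hx hxB := by
  ext f
  constructor
  · rintro ⟨r, hr, n, rfl⟩
    rw [← inv_pow]
    exact mul_mem (h hr) (pow_mem (inv_mem_oreFractions hx hxB) n)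
  · intro hf
    obtain ⟨m, hm⟩ := exists_mul_pow_mem hx hxB hf
    exact ⟨_, hm, m, by rw [mul_assoc, mul_inv_cancel₀ (pow_ne_zero m hx), mul_one]⟩

theorem isRegularOreSet_powers (h : B ≤ oreFractions B hx hxB) :
    IsRegularOreSet (Submonoid.powers (⟨x, hxB⟩ : B)) where
  regular := by
    rintro _ ⟨n, rfl⟩
    have : (⟨x, hxB⟩ : B) ^ n ≠ 0 := pow_ne_zero n fun h0 => hx (congrArg Subtype.val h0)
    exact IsRegular.of_ne_zero this
  right_ore := by
    rintro r _ ⟨n, rfl⟩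
    obtain ⟨m, hm⟩ := (h r.2).1 n
    refine ⟨⟨_, hm⟩, _, ⟨m, rfl⟩, Subtype.ext ?_⟩
    change (r : F) * x ^ m = x ^ n * (x⁻¹ ^ n * r * x ^ m)
    rw [mul_assoc, inv_pow, mul_inv_cancel_left₀ (pow_ne_zero n hx)]
  left_ore := by
    rintro r _ ⟨n, rfl⟩
    obtain ⟨m, hm⟩ := (h r.2).2 n
    refine ⟨⟨_, hm⟩, _, ⟨m, rfl⟩, Subtype.ext ?_⟩
    change x ^ m * (r : F) = x ^ m * r * x⁻¹ ^ n * x ^ n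
    rw [inv_pow, inv_mul_cancel_right₀ (pow_ne_zero n hx)]

namespace IsDeletable

variable {R : Type*} [Ring R] [Algebra K R] {q : K} {σ : R ≃ₐ[K] R} {δ : R →ₗ[K] R}
  {d : ℕ → R →ₗ[K] R} {φ : R →ₐ[K] F} (H : IsDeletable q σ δ d φ x)

include H

theorem deletionFun_mul_pow_mem (h : ∀ r, φ r ∈ B) (hxB : x ∈ B) {r : R} {m : ℕ}
    (hm : ∀ n, m ≤ n → d n r = 0) : deletionFun q σ d φ x r * x ^ m ∈ B := by
  have h1 : ∀ f ∈ polyLT φ x m, f ∈ B := by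
    rintro _ ⟨s, rfl⟩
    exact sum_mem fun n _ => mul_mem (h _) (pow_mem hxB n)
  have h2 := add_mem (h1 _ (H.deletionFun_mul_pow_sub_mem hm)) (mul_mem (h r) (pow_mem hxB m))
  rwa [sub_add_cancel] at h2

/-- The nilpotency degree of `r` bounds that of all `σ^n(r)`, so one power of `x` clears the
denominators of all conjugates of the image of `r`. -/
theorem deletionHom_mem_oreFractions (h : ∀ r, φ r ∈ B) (r : R) :
    H.deletionHom r ∈ oreFractions B H.ne_zero hxB := by
  rw [deletionHom_apply]
  obtain ⟨m, hm⟩ := H.locallyNilpotent r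
  refine ⟨fun n => ⟨n + m, ?_⟩, fun n => ⟨m + n, ?_⟩⟩
  · rw [H.inv_pow_mul_deletionFun, mul_assoc, pow_add, inv_pow,
      inv_mul_cancel_left₀ (pow_ne_zero n H.ne_zero)]
    exact H.deletionFun_mul_pow_mem h hxB fun k hk => H.d_symm_iterate_eq_zero (hm k hk) n
  · rw [H.pow_mul_deletionFun, mul_assoc, pow_add, mul_assoc, inv_pow,
      mul_inv_cancel₀ (pow_ne_zero n H.ne_zero), mul_one]
    exact H.deletionFun_mul_pow_mem h hxB fun k hk => by
      rw [H.d_iterate, hm k hk, Function.iterate_fixed (map_zero σ), smul_zero]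

end IsDeletable

end Fractions

/-! ### Ore extensions and conjugation -/

section OreExtension

variable {K : Type*} [Field K]

/-- The powers of the variable of an Ore extension are left independent; the uniqueness of polynomial
expressions in a form without finitely supported functions. -/
theorem IsOreExtension.eq_zero_of_sum {B : Type*} [Ring B] [Algebra K B] {R S : Subalgebra K B}
    {x : B} {σ : R ≃ₐ[K] R} {δ : R →ₗ[K] R} (h : IsOreExtension R S x σ δ) {T : ℕ} (r : ℕ → R)
    (hr : ∑ n ∈ Finset.range T, (r n : B) * x ^ n = 0) : ∀ n < T, r n = 0 := by
  classical
  let p : ℕ →₀ R := Finsupp.onFinset (Finset.range T) (fun n => if n < T then r n else 0)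
    fun n hn => Finset.mem_range.mpr (by by_contra h; exact hn (if_neg h))
  have hp : (p.sum fun n r => (r : B) * x ^ n) = 0 := by
    rw [Finsupp.onFinset_sum _ fun n => by simp, ← hr]
    exact Finset.sum_congr rfl fun n hn => by rw [if_pos (Finset.mem_range.mp hn)]
  have h0 : p = 0 := (h.basis 0 (zero_mem S)).unique hp Finsupp.sum_zero_index
  intro n hn
  have := DFunLike.congr_fun h0 n
  simpa [p, hn] using this

theorem IsOreExtension.ne_zero {B : Type*} [Ring B] [Nontrivial B] [Algebra K B]
    {R S : Subalgebra K B} {x : B} {σ : R ≃ₐ[K] R} {δ : R →ₗ[K] R}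
    (h : IsOreExtension R S x σ δ) : x ≠ 0 := by
  rintro rfl
  have := h.eq_zero_of_sum (T := 2) (fun n => if n = 1 then 1 else 0)
    (by simp [Finset.sum_range_succ]) 1 (by norm_num)
  simp at this

variable {F : Type*} [DivisionRing F] [Algebra K F]

/-- Conjugation by `u`, restricted to a subalgebra that it preserves. -/
def conjEquiv (R : Subalgebra K F) {u : F} (hu : u ≠ 0) (h : ∀ a ∈ R, u * a * u⁻¹ ∈ R)
    (h' : ∀ a ∈ R, u⁻¹ * a * u ∈ R) : R ≃ₐ[K] R where
  toFun a := ⟨u * a * u⁻¹, h a a.2⟩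
  invFun a := ⟨u⁻¹ * a * u, h' a a.2⟩
  left_inv a := Subtype.ext (by simp [mul_assoc, hu])
  right_inv a := Subtype.ext (by simp [mul_assoc, hu])
  map_mul' a b := Subtype.ext (by simp [mul_assoc, hu])
  map_add' a b := Subtype.ext (by simp [mul_add, add_mul])
  commutes' c := Subtype.ext (by
    change u * algebraMap K F c * u⁻¹ = algebraMap K F c
    rw [← Algebra.commutes, mul_assoc, mul_inv_cancel₀ hu, mul_one])

theorem conj_mem_adjoin {G : Set F} {u : F} (hu : u ≠ 0)
    (h : ∀ g ∈ G, u * g * u⁻¹ ∈ Algebra.adjoin K G) {a : F} (ha : a ∈ Algebra.adjoin K G) :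
    u * a * u⁻¹ ∈ Algebra.adjoin K G := by
  induction ha using Algebra.adjoin_induction with
  | mem g hg => exact h g hg
  | algebraMap c =>
    rw [← Algebra.commutes, mul_assoc, mul_inv_cancel₀ hu, mul_one]
    exact Subalgebra.algebraMap_mem _ c
  | add a b _ _ ha hb =>
    rw [mul_add, add_mul]
    exact add_mem ha hb
  | mul a b _ _ ha hb =>
    have : u * (a * b) * u⁻¹ = u * a * u⁻¹ * (u * b * u⁻¹) := by simp [mul_assoc, hu]
    rw [this]
    exact mul_mem ha hb

/-- Over a subalgebra `R` normalized by `x`, the algebra generated by `R` and `x` is an Ore extension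
without derivation as soon as the powers of `x` are independent over `R`. -/
theorem isOreExtension_of_conj {R S : Subalgebra K F} {x : F} (hx : x ≠ 0) (τ : R ≃ₐ[K] R)
    (hτ : ∀ r, (τ r : F) = x * r * x⁻¹) (hS : S = Algebra.adjoin K (insert x (R : Set F)))
    (indep : ∀ (T : ℕ) (r : ℕ → R), ∑ n ∈ Finset.range T, (r n : F) * x ^ n = 0 →
      ∀ n < T, r n = 0) : IsOreExtension R S x τ 0 where
  le := by
    rw [hS]
    exact fun r hr => Algebra.subset_adjoin (Set.mem_insert_of_mem _ hr)
  mem := by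
    rw [hS]
    exact Algebra.subset_adjoin (Set.mem_insert _ _)
  derivation := by simp
  comm r := by simp [hτ, mul_assoc, hx]
  basis := by
    have hcomm (r : R) : x * (r : F) = τ r * x := by simp [hτ, mul_assoc, hx]
    let ev (p : ℕ →₀ R) : F := p.sum fun n r => (r : F) * x ^ n
    have hadd (p p' : ℕ →₀ R) : ev (p + p') = ev p + ev p' :=
      Finsupp.sum_add_index' (by simp) (by simp [add_mul])
    have hsub (p p' : ℕ →₀ R) : ev (p - p') = ev p - ev p' :=
      Finsupp.sum_sub_index (by simp [sub_mul])
    have hsingle (n : ℕ) (r : R) : ev (Finsupp.single n r) = r * x ^ n :=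
      Finsupp.sum_single_index (by simp)
    -- The polynomials in `x` are stable under left multiplication by the generators, so they
    -- make up the whole algebra.
    have hmonomial (f : F) (h0 : ∀ (n : ℕ) (r : R), ∃ p, ev p = f * (r * x ^ n)) (p : ℕ →₀ R) :
        ∃ p', ev p' = f * ev p := by
      induction p using Finsupp.induction_linear with
      | zero => exact ⟨0, by simp [ev]⟩
      | add p p' h h' =>
        obtain ⟨a, ha⟩ := h
        obtain ⟨b, hb⟩ := h'
        exact ⟨a + b, by rw [hadd, hadd, mul_add, ha, hb]⟩
      | single n r => rw [hsingle]; exact h0 n r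
    have hstable {f : F} (hf : f ∈ S) : ∀ p, ∃ p', ev p' = f * ev p := by
      rw [hS] at hf
      induction hf using Algebra.adjoin_induction with
      | mem g hg =>
        refine hmonomial g fun n r => ?_
        rcases hg with rfl | hg
        · exact ⟨Finsupp.single (n + 1) (τ r), by
            rw [hsingle, pow_succ', ← mul_assoc, ← mul_assoc, hcomm]⟩
        · exact ⟨Finsupp.single n (⟨g, hg⟩ * r), by rw [hsingle]; simp [mul_assoc]⟩
      | algebraMap c =>
        exact hmonomial _ fun n r => ⟨Finsupp.single n (c • r), by
          rw [hsingle]; simp [Algebra.smul_def, mul_assoc]⟩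
      | add a b _ _ ha hb =>
        intro p
        obtain ⟨a', ha⟩ := ha p
        obtain ⟨b', hb⟩ := hb p
        exact ⟨a' + b', by rw [hadd, ha, hb, add_mul]⟩
      | mul a b _ _ ha hb =>
        intro p
        obtain ⟨b', hb⟩ := hb p
        obtain ⟨a', ha⟩ := ha b'
        exact ⟨a', by rw [ha, hb, mul_assoc]⟩
    have hinj (p : ℕ →₀ R) (hp : ev p = 0) : p = 0 := by
      have h1 : ev p = ∑ n ∈ Finset.range (p.support.sup id + 1), (p n : F) * x ^ n :=
        Finsupp.sum_of_support_subset p (Finset.subset_range_sup_succ _) _ (by simp)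
      ext n
      by_cases hn : n < p.support.sup id + 1
      · rw [indep _ p (h1 ▸ hp) n hn]; rfl
      · have : n ∉ p.support := fun h =>
          hn (Finset.mem_range.mp (Finset.subset_range_sup_succ _ h))
        rw [Finsupp.notMem_support_iff.mp this]; rfl
    intro s hs
    obtain ⟨p, hp⟩ := hstable hs (Finsupp.single 0 1)
    rw [hsingle, pow_zero, mul_one, OneMemClass.coe_one, mul_one] at hp
    refine ⟨p, hp, fun p' hp' => ?_⟩
    exact sub_eq_zero.mp (hinj _ (by rw [hsub, hp, sub_eq_zero]; exact hp'))

end OreExtension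

/-! ### Algebras generated by initial segments -/

section GenSubalg

variable {K : Type*} [Field K] {B : Type*} [Ring B] [Algebra K B] {N : ℕ} {x : Fin N → B}

theorem genSubalg_induction {k : ℕ} {p : genSubalg K x k → Prop}
    (gen : ∀ (l : Fin N) (h : (l : ℕ) < k), p ⟨x l, mem_genSubalg x h⟩)
    (algebraMap : ∀ c, p (algebraMap K _ c)) (add : ∀ a b, p a → p b → p (a + b))
    (mul : ∀ a b, p a → p b → p (a * b)) (a : genSubalg K x k) : p a := by
  obtain ⟨a, ha⟩ := a
  refine Algebra.adjoin_induction (p := fun a ha => p ⟨a, ha⟩) ?_ algebraMap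
    (fun a b ha hb => add ⟨a, ha⟩ ⟨b, hb⟩) (fun a b ha hb => mul ⟨a, ha⟩ ⟨b, hb⟩) ha
  rintro _ ⟨l, hl, rfl⟩
  exact gen l hl

theorem genSubalg_le {k : ℕ} {C : Subalgebra K B} (h : ∀ l : Fin N, (l : ℕ) < k → x l ∈ C) :
    genSubalg K x k ≤ C := by
  refine Algebra.adjoin_le ?_
  rintro _ ⟨l, hl, rfl⟩
  exact h l hl

theorem genSubalg_succ (i : Fin N) : genSubalg K x (i + 1) =
    Algebra.adjoin K (insert (x i) (genSubalg K x i : Set B)) := by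
  refine le_antisymm (genSubalg_le fun l hl => ?_) (Algebra.adjoin_le ?_)
  · rcases Nat.lt_succ_iff_lt_or_eq.mp hl with hl | hl
    · exact Algebra.subset_adjoin (Set.mem_insert_of_mem _ (mem_genSubalg x hl))
    · rw [Fin.ext hl]
      exact Algebra.subset_adjoin (Set.mem_insert _ _)
  · rintro _ (rfl | ha)
    · exact mem_genSubalg x (Nat.lt_succ_self _)
    · exact genSubalg_mono x (Nat.le_succ _) ha

end GenSubalg

/-! ### One step of the deleting derivations algorithm -/

namespace QuantumNilpotentAlgebra

variable {K : Type*} [Field K] {A : Type*} [Ring A] [Algebra K A] {N : ℕ}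
  (Q : QuantumNilpotentAlgebra K A N) {F : Type*} [DivisionRing F] [Algebra K F]

/-- The junk value does not occur: as soon as the required homomorphism exists, `identify` is it. -/
theorem identify_eq {x : Fin N → F} {k : ℕ} (ψ : genSubalg K Q.X k →ₐ[K] F)
    (h : ∀ (l : Fin N) (hl : (l : ℕ) < k), ψ ⟨Q.X l, mem_genSubalg Q.X hl⟩ = x l)
    (a : genSubalg K Q.X k) : Q.identify x k a = ψ a := by
  have hex : ∃ θ : genSubalg K Q.X k →ₐ[K] F,
      ∀ (l : Fin N) (hl : (l : ℕ) < k), θ ⟨Q.X l, mem_genSubalg Q.X hl⟩ = x l := ⟨ψ, h⟩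
  rw [identify, dif_pos hex]
  have hc := hex.choose_spec
  generalize hex.choose = θ at hc
  induction a using genSubalg_induction with
  | gen l hl => rw [hc l hl, h l hl]
  | algebraMap c => rw [AlgHom.commutes, AlgHom.commutes]
  | add a b ha hb => rw [map_add, map_add, ha, hb]
  | mul a b ha hb => rw [map_mul, map_mul, ha, hb]

theorem gens_castSucc (ι : A →ₐ[K] F) (j : Fin N) :
    Q.gens ι j.castSucc = Q.deleteStep j (Q.gens ι j.succ) := by
  simp [gens, Fin.reverseInduction_castSucc]

/-- The embedding of `K⟨X_l : l < j⟩` in `F` induced by an identification of `K⟨X_l : l ≤ j⟩`. -/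
def lowerEmb {x : Fin N → F} {j : Fin N}
    (θ : genSubalg K Q.X (j + 1) ≃ₐ[K] genSubalg K x (j + 1)) : genSubalg K Q.X j →ₐ[K] F :=
  (genSubalg K x (j + 1)).val.comp
    ((θ : genSubalg K Q.X (j + 1) →ₐ[K] genSubalg K x (j + 1)).comp
      (Subalgebra.inclusion (genSubalg_mono Q.X (Nat.le_succ j))))

theorem lowerEmb_apply {x : Fin N → F} {j : Fin N}
    (θ : genSubalg K Q.X (j + 1) ≃ₐ[K] genSubalg K x (j + 1)) (a : genSubalg K Q.X j) :
    Q.lowerEmb θ a =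
      (θ (Subalgebra.inclusion (genSubalg_mono Q.X (Nat.le_succ j)) a) : F) := rfl

theorem lowerEmb_injective {x : Fin N → F} {j : Fin N}
    (θ : genSubalg K Q.X (j + 1) ≃ₐ[K] genSubalg K x (j + 1)) :
    Function.Injective (Q.lowerEmb θ) := by
  intro a b h
  rw [lowerEmb_apply, lowerEmb_apply] at h
  exact Subalgebra.inclusion_injective (genSubalg_mono Q.X (Nat.le_succ j))
    (θ.injective (Subtype.ext h))

variable {Q} {j : Fin N} {x : Fin N → F}
  {θ : genSubalg K Q.X (j + 1) ≃ₐ[K] genSubalg K x (j + 1)}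
  {τ : ∀ i : Fin N, (j : ℕ) + 1 ≤ (i : ℕ) → genSubalg K x i ≃ₐ[K] genSubalg K x i}

theorem lam_mul_lam (i l : Fin N) : (Q.lam i l : K) * Q.lam l i = 1 := by
  rw [Q.lam_antisymm i l, Units.inv_mul]

namespace IsPresentation

variable (hpres : Q.IsPresentation x (j + 1) θ τ)
include hpres

theorem lowerEmb_gen (l : Fin N) (h : (l : ℕ) < j) :
    Q.lowerEmb θ ⟨Q.X l, mem_genSubalg Q.X h⟩ = x l :=
  hpres.map_gen l (h.trans (Nat.lt_succ_self _))

theorem isDeletable (hj : 0 < (j : ℕ)) :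
    IsDeletable (Q.q j : K) (Q.σ j) (Q.δ j) (Q.d j) (Q.lowerEmb θ) (x j) := by
  have hA : Nontrivial A := Q.algebraMap_injective.nontrivial
  have hxj : (θ ⟨Q.X j, mem_genSubalg Q.X (Nat.lt_succ_self _)⟩ : F) = x j :=
    hpres.map_gen j (Nat.lt_succ_self _)
  exact
  { q_ne_zero := (Q.q j).ne_zero
    q_ne_one := fun h => Q.q_ne_one j hj (Units.ext h)
    higher := Q.higher j hj
    locallyNilpotent := Q.locallyNilpotent j hj
    iterative := Q.iterative j hj
    ne_zero := by
      rw [← hxj]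
      intro h0
      rw [ZeroMemClass.coe_eq_zero, map_eq_zero_iff θ θ.injective] at h0
      exact (Q.ore j).ne_zero (congrArg Subtype.val h0)
    comm := fun r => by
      rw [lowerEmb_apply, lowerEmb_apply, lowerEmb_apply, ← hxj, ← MulMemClass.coe_mul,
        ← MulMemClass.coe_mul, ← AddMemClass.coe_add, ← map_mul, ← map_mul, ← map_add]
      exact congrArg (fun z => (θ z : F)) (Subtype.ext ((Q.ore j).comm r))
    indep := fun T r h => by
      refine (Q.ore j).eq_zero_of_sum r ?_
      have h1 : (∑ n ∈ Finset.range T,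
          Subalgebra.inclusion (genSubalg_mono Q.X (Nat.le_succ j)) (r n) *
            (⟨Q.X j, mem_genSubalg Q.X (Nat.lt_succ_self _)⟩ : genSubalg K Q.X (j + 1)) ^ n) =
          0 := by
        apply θ.injective
        apply Subtype.val_injective
        rw [map_zero, ZeroMemClass.coe_zero, ← h]
        simp only [map_sum, map_mul, map_pow, AddSubmonoidClass.coe_finsetSum,
          MulMemClass.coe_mul, SubmonoidClass.coe_pow, lowerEmb_apply, hxj]
      have h2 := congrArg Subtype.val h1
      simpa using h2 }

theorem deleteStep_of_lt (hj : 0 < (j : ℕ)) {l : Fin N} (h : (l : ℕ) < j) :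
    Q.deleteStep j x l =
      (hpres.isDeletable hj).deletionHom ⟨Q.X l, mem_genSubalg Q.X h⟩ := by
  rw [deleteStep, dif_pos h, IsDeletable.deletionHom_apply, deletionFun]
  simp only [Q.identify_eq (Q.lowerEmb θ) hpres.lowerEmb_gen, deletionCoeff]

omit hpres in
theorem deleteStep_of_le {l : Fin N} (h : (j : ℕ) ≤ l) : Q.deleteStep j x l = x l := by
  rw [deleteStep, dif_neg (by omega)]

theorem gen_ne_zero (hj : 0 < (j : ℕ)) {i : Fin N} (h : (j : ℕ) ≤ i) : x i ≠ 0 := by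
  rcases h.eq_or_lt with h | h
  · rw [← Fin.ext h]
    exact (hpres.isDeletable hj).ne_zero
  · exact (hpres.ore i h).ne_zero

theorem conj_eq {i : Fin N} (hi : (j : ℕ) + 1 ≤ i) (a : genSubalg K x i) :
    x i * (a : F) * (x i)⁻¹ = τ i hi a := by
  rw [(hpres.ore i hi).comm, LinearMap.zero_apply, ZeroMemClass.coe_zero, add_zero, mul_assoc,
    mul_inv_cancel₀ (hpres.ore i hi).ne_zero, mul_one]

theorem deletionHom_mem_genSubalg (hj : 0 < (j : ℕ)) (a : genSubalg K Q.X j) :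
    (hpres.isDeletable hj).deletionHom a ∈ genSubalg K (Q.deleteStep j x) j := by
  induction a using genSubalg_induction with
  | gen l h =>
    rw [← hpres.deleteStep_of_lt hj h]
    exact mem_genSubalg _ h
  | algebraMap c =>
    rw [AlgHom.commutes]
    exact Subalgebra.algebraMap_mem _ c
  | add a b ha hb =>
    rw [map_add]
    exact add_mem ha hb
  | mul a b ha hb =>
    rw [map_mul]
    exact mul_mem ha hb

theorem lowerEmb_mem_genSubalg {k : ℕ} (hk : (j : ℕ) ≤ k) (a : genSubalg K Q.X j) :
    Q.lowerEmb θ a ∈ genSubalg K x k := by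
  induction a using genSubalg_induction with
  | gen l h =>
    rw [hpres.lowerEmb_gen l h]
    exact mem_genSubalg _ (h.trans_le hk)
  | algebraMap c =>
    rw [AlgHom.commutes]
    exact Subalgebra.algebraMap_mem _ c
  | add a b ha hb =>
    rw [map_add]
    exact add_mem ha hb
  | mul a b ha hb =>
    rw [map_mul]
    exact mul_mem ha hb

/-- The identification of `K⟨X_l : l < j⟩` with `K⟨y_l : l < j⟩` by the deletion map. -/
noncomputable def deletionEquiv (hj : 0 < (j : ℕ)) :
    genSubalg K Q.X j ≃ₐ[K] genSubalg K (Q.deleteStep j x) j :=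
  AlgEquiv.ofBijective
    ((hpres.isDeletable hj).deletionHom.codRestrict _ (hpres.deletionHom_mem_genSubalg hj)) <| by
    refine ⟨fun a b h => (hpres.isDeletable hj).deletionHom_injective (congrArg Subtype.val h),
      fun f => ?_⟩
    have h : genSubalg K (Q.deleteStep j x) j ≤ (hpres.isDeletable hj).deletionHom.range :=
      genSubalg_le fun l hl => ⟨_, (hpres.deleteStep_of_lt hj hl).symm⟩
    obtain ⟨a, ha⟩ := h f.2
    exact ⟨a, Subtype.ext ha⟩

theorem deletionEquiv_apply (hj : 0 < (j : ℕ)) (a : genSubalg K Q.X j) :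
    (hpres.deletionEquiv hj a : F) = (hpres.isDeletable hj).deletionHom a := rfl

variable (hcomp : Q.IsCompatible x (j + 1) θ τ)
include hcomp

theorem conj_gen {i l : Fin N} (hi : (j : ℕ) + 1 ≤ i) (hl : (l : ℕ) < i) :
    x i * x l * (x i)⁻¹ = (Q.lam i l : K) • x l := by
  rw [← hcomp.scale i hi l hl, ← hpres.conj_eq]

/-- Conjugation by a later generator commutes with the deletion map. -/
theorem conj_deletionHom (hj : 0 < (j : ℕ)) {i : Fin N} (hi : (j : ℕ) + 1 ≤ i)
    (a : genSubalg K Q.X j) : ∃ b, x i * Q.lowerEmb θ a * (x i)⁻¹ = Q.lowerEmb θ b ∧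
      x i * (hpres.isDeletable hj).deletionHom a * (x i)⁻¹ =
        (hpres.isDeletable hj).deletionHom b := by
  have hne : x i ≠ 0 := hpres.gen_ne_zero hj (by omega)
  have hconj_mul (f g : F) : x i * (f * g) * (x i)⁻¹ = x i * f * (x i)⁻¹ * (x i * g * (x i)⁻¹) := by
    simp [mul_assoc, hne]
  have hconj_inv (n : ℕ) : x i * (x j)⁻¹ ^ n * (x i)⁻¹ =
      ((Q.lam i j : K) ^ n)⁻¹ • (x j)⁻¹ ^ n := by
    have h1 := hpres.conj_gen hcomp hi (l := j) (by omega)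
    induction n with
    | zero => simp [hne]
    | succ n ih =>
      have h2 : x i * (x j)⁻¹ * (x i)⁻¹ = (Q.lam i j : K)⁻¹ • (x j)⁻¹ := by
        rw [← smul_inv₀, ← h1]
        simp [mul_assoc]
      rw [pow_succ, hconj_mul, ih, h2, smul_mul_smul_comm, pow_succ, mul_inv]
  induction a using genSubalg_induction with
  | gen l hl =>
    have hli : (l : ℕ) < i := by omega
    refine ⟨(Q.lam i l : K) • ⟨Q.X l, mem_genSubalg Q.X hl⟩, ?_, ?_⟩
    · rw [map_smul, hpres.lowerEmb_gen l hl, hpres.conj_gen hcomp hi hli]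
    · have hsymm (n : ℕ) : (⇑(Q.σ j).symm)^[n] ⟨Q.X l, mem_genSubalg Q.X hl⟩ =
          ((Q.lam j l : K) ^ n)⁻¹ • (⟨Q.X l, mem_genSubalg Q.X hl⟩ : genSubalg K Q.X j) := by
        have h1 : (Q.σ j).symm ⟨Q.X l, mem_genSubalg Q.X hl⟩ =
            (Q.lam j l : K)⁻¹ • (⟨Q.X l, mem_genSubalg Q.X hl⟩ : genSubalg K Q.X j) := by
          rw [AlgEquiv.symm_apply_eq, map_smul, eq_inv_smul_iff₀ (Q.lam j l).ne_zero]
          exact Subtype.ext (Q.σ_gen j l hl).symm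
        induction n with
        | zero => simp
        | succ n ih => rw [Function.iterate_succ_apply', ih, map_smul, h1, smul_smul, pow_succ,
            mul_inv]
      have hd (n : ℕ) : x i *
          Q.lowerEmb θ (Q.d j n ⟨Q.X l, mem_genSubalg Q.X hl⟩) * (x i)⁻¹ =
          ((Q.lam i j : K) ^ n * Q.lam i l) •
            Q.lowerEmb θ (Q.d j n ⟨Q.X l, mem_genSubalg Q.X hl⟩) := by
        obtain ⟨b, hb, hb'⟩ := hcomp.comp_d i hi j hj (Nat.lt_succ_self _) n
          ⟨Q.X l, mem_genSubalg Q.X hl⟩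
        rw [← hpres.conj_eq] at hb hb'
        have h1 : b = (Q.lam i l : K) • ⟨Q.X l, mem_genSubalg Q.X hl⟩ := by
          apply Q.lowerEmb_injective θ
          rw [map_smul, hpres.lowerEmb_gen l hl, ← hpres.conj_gen hcomp hi hli,
            ← hpres.lowerEmb_gen l hl]
          exact hb.symm
        rw [h1, map_smul] at hb'
        rw [mul_smul, ← map_smul (Q.lowerEmb θ)]
        exact hb'
      obtain ⟨m, hm⟩ := Q.locallyNilpotent j hj ⟨Q.X l, mem_genSubalg Q.X hl⟩
      rw [map_smul, IsDeletable.deletionHom_apply, (hpres.isDeletable hj).deletionFun_eq_sum hm,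
        Finset.mul_sum, Finset.sum_mul, Finset.smul_sum]
      refine Finset.sum_congr rfl fun n _ => ?_
      -- The factors `λ_{i,j}^n` from `d_{j,n}` and from `x_j⁻ⁿ` cancel.
      rw [mul_smul_comm, smul_mul_assoc, hconj_mul, hconj_inv, hsymm, map_smul, map_smul,
        mul_smul_comm, mul_smul_comm, smul_mul_assoc (Q.lam j l ^ n : K)⁻¹, hd, smul_mul_assoc,
        smul_mul_assoc, smul_mul_assoc]
      simp only [smul_smul]
      congr 1
      have := (Q.lam i j).ne_zero
      field_simp
  | algebraMap c =>
    refine ⟨algebraMap K _ c, ?_, ?_⟩ <;>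
    · rw [AlgHom.commutes, ← Algebra.commutes, mul_assoc, mul_inv_cancel₀ hne, mul_one]
  | add a b ha hb =>
    obtain ⟨a', h1, h2⟩ := ha
    obtain ⟨b', h3, h4⟩ := hb
    exact ⟨a' + b', by rw [map_add, map_add, mul_add, add_mul, h1, h3],
      by rw [map_add, map_add, mul_add, add_mul, h2, h4]⟩
  | mul a b ha hb =>
    obtain ⟨a', h1, h2⟩ := ha
    obtain ⟨b', h3, h4⟩ := hb
    exact ⟨a' * b', by rw [map_mul, map_mul, hconj_mul, h1, h3],
      by rw [map_mul, map_mul, hconj_mul, h2, h4]⟩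

/-- From the `j`-th on, the new generators `q`-commute with all earlier ones. -/
theorem conj_deleteStep (hj : 0 < (j : ℕ)) {i l : Fin N} (hi : (j : ℕ) ≤ i) (hl : (l : ℕ) < i) :
    x i * Q.deleteStep j x l * (x i)⁻¹ = (Q.lam i l : K) • Q.deleteStep j x l := by
  rcases lt_or_ge (l : ℕ) j with h | h
  · rw [hpres.deleteStep_of_lt hj h, ← map_smul]
    rcases hi.eq_or_lt with hi | hi
    · obtain rfl := Fin.ext hi
      rw [IsDeletable.deletionHom_apply, (hpres.isDeletable hj).mul_deletionFun, mul_assoc,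
        mul_inv_cancel₀ (hpres.gen_ne_zero hj le_rfl), mul_one]
      exact congrArg (hpres.isDeletable hj).deletionHom (Subtype.ext (Q.σ_gen j l hl))
    · obtain ⟨b, hb, hb'⟩ := hpres.conj_deletionHom hcomp hj hi ⟨Q.X l, mem_genSubalg Q.X h⟩
      rw [hb']
      congr 1
      apply Q.lowerEmb_injective θ
      rw [← hb, map_smul, hpres.lowerEmb_gen l h, hpres.conj_gen hcomp hi hl]
  · rw [deleteStep_of_le h, hpres.conj_gen hcomp (by omega) hl]

theorem conj_mem (hj : 0 < (j : ℕ)) {i : Fin N} (hi : (j : ℕ) ≤ i) {a : F}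
    (ha : a ∈ genSubalg K (Q.deleteStep j x) i) :
    x i * a * (x i)⁻¹ ∈ genSubalg K (Q.deleteStep j x) i := by
  refine conj_mem_adjoin (hpres.gen_ne_zero hj hi) ?_ ha
  rintro _ ⟨l, hl, rfl⟩
  rw [hpres.conj_deleteStep hcomp hj hi hl]
  exact Subalgebra.smul_mem _ (mem_genSubalg _ hl) _

theorem conj_inv_mem (hj : 0 < (j : ℕ)) {i : Fin N} (hi : (j : ℕ) ≤ i) {a : F}
    (ha : a ∈ genSubalg K (Q.deleteStep j x) i) :
    (x i)⁻¹ * a * x i ∈ genSubalg K (Q.deleteStep j x) i := by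
  have hne := hpres.gen_ne_zero hj hi
  rw [← inv_inv (x i), inv_inv (x i)⁻¹]
  refine conj_mem_adjoin (inv_ne_zero hne) ?_ ha
  rintro _ ⟨l, hl, rfl⟩
  have h : (x i)⁻¹ * Q.deleteStep j x l * (x i)⁻¹⁻¹ =
      (Q.lam i l : K)⁻¹ • Q.deleteStep j x l := by
    rw [eq_inv_smul_iff₀ (Q.lam i l).ne_zero, ← smul_mul_assoc, ← mul_smul_comm,
      ← hpres.conj_deleteStep hcomp hj hi hl]
    simp [mul_assoc, hne]
  rw [h]
  exact Subalgebra.smul_mem _ (mem_genSubalg _ hl) _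

/-- The automorphism `τ_i` after the deletion step: conjugation by `x_i`. -/
noncomputable def deletionAut (hj : 0 < (j : ℕ)) (i : Fin N) (hi : (j : ℕ) ≤ i) :
    genSubalg K (Q.deleteStep j x) i ≃ₐ[K] genSubalg K (Q.deleteStep j x) i :=
  conjEquiv _ (hpres.gen_ne_zero hj hi) (fun _ => hpres.conj_mem hcomp hj hi)
    (fun _ => hpres.conj_inv_mem hcomp hj hi)

theorem deletionAut_apply (hj : 0 < (j : ℕ)) (i : Fin N) (hi : (j : ℕ) ≤ i)
    (a : genSubalg K (Q.deleteStep j x) i) :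
    (hpres.deletionAut hcomp hj i hi a : F) = x i * a * (x i)⁻¹ := rfl

theorem mul_gen_of_lt {l : Fin N} (h : (j : ℕ) < l) :
    x j * x l = (Q.lam j l : K) • (x l * x j) := by
  have h1 := hpres.conj_gen hcomp (i := l) (l := j) h h
  rw [mul_inv_eq_iff_eq_mul₀ (hpres.ore l h).ne_zero, smul_mul_assoc] at h1
  rw [h1, smul_smul, lam_mul_lam, one_smul]

theorem genSubalg_deleteStep_le (hj : 0 < (j : ℕ)) {k : ℕ}
    (hxk : x j ∈ genSubalg K (Q.deleteStep j x) k) :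
    genSubalg K (Q.deleteStep j x) k ≤
      oreFractions (genSubalg K (Q.deleteStep j x) k) (hpres.gen_ne_zero hj le_rfl) hxk := by
  refine genSubalg_le fun l hl => ?_
  rcases lt_trichotomy (l : ℕ) j with h | h | h
  · refine mem_oreFractions_of_conj _ _ (mem_genSubalg _ hl) (c := Q.lam j l) ?_
    have h1 := hpres.conj_deleteStep hcomp hj le_rfl h
    rwa [mul_inv_eq_iff_eq_mul₀ (hpres.gen_ne_zero hj le_rfl), smul_mul_assoc] at h1
  · refine mem_oreFractions_of_conj _ _ (mem_genSubalg _ hl) (c := 1) ?_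
    rw [deleteStep_of_le h.ge, Fin.ext h]
    simp
  · refine mem_oreFractions_of_conj _ _ (mem_genSubalg _ hl) (c := Q.lam j l) ?_
    rw [deleteStep_of_le h.le, hpres.mul_gen_of_lt hcomp h]

theorem genSubalg_le_deleteStep (hj : 0 < (j : ℕ)) {k : ℕ} (hk : (j : ℕ) < k)
    (hxk : x j ∈ genSubalg K (Q.deleteStep j x) k) :
    genSubalg K x k ≤
      oreFractions (genSubalg K (Q.deleteStep j x) k) (hpres.gen_ne_zero hj le_rfl) hxk := by
  have hle := hpres.genSubalg_deleteStep_le hcomp hj hxk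
  refine genSubalg_le fun l hl => ?_
  rcases lt_or_ge (l : ℕ) j with h | h
  · rw [← hpres.lowerEmb_gen l h]
    exact (hpres.isDeletable hj).mem_of_deletionHom_mem
      (fun r => hle (genSubalg_mono _ hk.le (hpres.deletionHom_mem_genSubalg hj r)))
      (inv_mem_oreFractions _ _) _
  · rw [← deleteStep_of_le (Q := Q) (x := x) h]
    exact hle (mem_genSubalg _ hl)

theorem genSubalg_le_oreFractions (hj : 0 < (j : ℕ)) {k : ℕ} (hk : (j : ℕ) < k) :
    genSubalg K x k ≤
      oreFractions (genSubalg K x k) (hpres.gen_ne_zero hj le_rfl) (mem_genSubalg x hk) := by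
  refine genSubalg_le fun l hl => ?_
  rcases lt_trichotomy (l : ℕ) j with h | h | h
  · rw [← hpres.lowerEmb_gen l h]
    exact (hpres.isDeletable hj).mem_of_deletionHom_mem
      ((hpres.isDeletable hj).deletionHom_mem_oreFractions _
        (hpres.lowerEmb_mem_genSubalg hk.le)) (inv_mem_oreFractions _ _) _
  · refine mem_oreFractions_of_conj _ _ (mem_genSubalg _ hl) (c := 1) ?_
    rw [Fin.ext h]
    simp
  · exact mem_oreFractions_of_conj _ _ (mem_genSubalg _ hl) (hpres.mul_gen_of_lt hcomp h)

theorem deleteStep_genSubalg_le (hj : 0 < (j : ℕ)) {k : ℕ} (hk : (j : ℕ) < k) :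
    genSubalg K (Q.deleteStep j x) k ≤
      oreFractions (genSubalg K x k) (hpres.gen_ne_zero hj le_rfl) (mem_genSubalg x hk) := by
  refine genSubalg_le fun l hl => ?_
  rcases lt_or_ge (l : ℕ) j with h | h
  · rw [hpres.deleteStep_of_lt hj h]
    exact (hpres.isDeletable hj).deletionHom_mem_oreFractions _
      (hpres.lowerEmb_mem_genSubalg hk.le) _
  · rw [deleteStep_of_le h]
    exact hpres.genSubalg_le_oreFractions hcomp hj hk (mem_genSubalg _ hl)

/-- Both algebras have the same localization at `x_j`. -/
theorem oreFractions_deleteStep (hj : 0 < (j : ℕ)) {k : ℕ} (hk : (j : ℕ) < k)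
    (hxk : x j ∈ genSubalg K (Q.deleteStep j x) k) :
    oreFractions (genSubalg K (Q.deleteStep j x) k) (hpres.gen_ne_zero hj le_rfl) hxk =
      oreFractions (genSubalg K x k) (hpres.gen_ne_zero hj le_rfl) (mem_genSubalg x hk) := by
  refine le_antisymm (fun f hf => ?_) fun f hf => ?_
  · obtain ⟨m, hm⟩ := exists_mul_pow_mem _ _ hf
    exact mem_of_mul_pow_mem (hpres.gen_ne_zero hj le_rfl) (inv_mem_oreFractions _ _)
      (hpres.deleteStep_genSubalg_le hcomp hj hk hm)
  · obtain ⟨m, hm⟩ := exists_mul_pow_mem _ _ hf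
    exact mem_of_mul_pow_mem (hpres.gen_ne_zero hj le_rfl) (inv_mem_oreFractions _ _)
      (hpres.genSubalg_le_deleteStep hcomp hj hk hxk hm)

/-- From the `j`-th on, the powers of each generator are independent over the algebra of the earlier
new generators. -/
theorem gen_indep (hj : 0 < (j : ℕ)) {i : Fin N} (hi : (j : ℕ) ≤ i) (T : ℕ)
    (r : ℕ → genSubalg K (Q.deleteStep j x) i)
    (hr : ∑ n ∈ Finset.range T, (r n : F) * x i ^ n = 0) : ∀ n < T, r n = 0 := by
  rcases hi.eq_or_lt with hi | hi
  · obtain rfl := Fin.ext hi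
    intro n hn
    have hs (n : ℕ) : (r n : F) = deletionFun (Q.q j : K) (Q.σ j) (Q.d j) (Q.lowerEmb θ) (x j)
        ((hpres.deletionEquiv hj).symm (r n)) := by
      rw [← IsDeletable.deletionHom_apply (hpres.isDeletable hj), ← hpres.deletionEquiv_apply hj,
        AlgEquiv.apply_symm_apply]
    have h := (hpres.isDeletable hj).deletionFun_indep T
      (fun n => (hpres.deletionEquiv hj).symm (r n)) (by simpa only [hs] using hr) n hn
    simpa using h
  · -- A common power of `x_j` moves the coefficients into `K⟨x_l : l < i⟩`.
    have hne := hpres.gen_ne_zero hj (le_refl (j : ℕ))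
    choose m hm using fun n =>
      exists_mul_pow_mem _ _ (hpres.deleteStep_genSubalg_le hcomp hj hi (r n).2)
    let L := (Finset.range T).sup m
    have hL (n : ℕ) (hn : n < T) : (r n : F) * x j ^ L ∈ genSubalg K x i := by
      obtain ⟨k, hk⟩ := Nat.exists_eq_add_of_le
        (show m n ≤ L from Finset.le_sup (Finset.mem_range.mpr hn))
      rw [hk, pow_add, ← mul_assoc]
      exact mul_mem (hm n) (pow_mem (mem_genSubalg x hi) k)
    have hij := hpres.conj_gen hcomp hi (l := j) hi
    rw [mul_inv_eq_iff_eq_mul₀ (hpres.gen_ne_zero hj hi.le), smul_mul_assoc] at hij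
    let s (n : ℕ) : genSubalg K x i :=
      if hn : n < T then (Q.lam i j : K) ^ (n * L) • ⟨_, hL n hn⟩ else 0
    have hs : ∑ n ∈ Finset.range T, (s n : F) * x i ^ n = 0 := by
      have h1 := congrArg (· * x j ^ L) hr
      simp only [zero_mul, Finset.sum_mul] at h1
      rw [← h1]
      refine Finset.sum_congr rfl fun n hn => ?_
      rw [mul_assoc (r n : F), pow_mul_pow_of_mul_eq_smul hij, mul_smul_comm, ← mul_assoc]
      simp only [s, dif_pos (Finset.mem_range.mp hn), SetLike.val_smul, smul_mul_assoc]
    intro n hn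
    have h1 := (hpres.ore i hi).eq_zero_of_sum s hs n hn
    simp only [s, dif_pos hn] at h1
    have h2 := (smul_eq_zero.mp h1).resolve_left (pow_ne_zero _ (Q.lam i j).ne_zero)
    have h3 := congrArg Subtype.val h2
    exact Subtype.ext ((mul_eq_zero.mp h3).resolve_right (pow_ne_zero L hne))

end IsPresentation

end QuantumNilpotentAlgebra

open QuantumNilpotentAlgebra IsPresentation in
theorem theorem2p2 {K : Type*} [Field K] {A : Type*} [Ring A] [Algebra K A] {N : ℕ}
    (Q : QuantumNilpotentAlgebra K A N)
    {F : Type*} [DivisionRing F] [Algebra K F] (ι : A →ₐ[K] F)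
    (hι : IsDivisionRingOfFractions ι)
    (j : Fin N) (hj : 0 < (j : ℕ))
    (x y : Fin N → F) (hx : x = Q.gens ι j.succ) (hy : y = Q.gens ι j.castSucc)
    (θ : genSubalg K Q.X (j + 1) ≃ₐ[K] genSubalg K x (j + 1))
    (τ : ∀ i : Fin N, (j : ℕ) + 1 ≤ (i : ℕ) → genSubalg K x i ≃ₐ[K] genSubalg K x i)
    (hpres : Q.IsPresentation x (j + 1) θ τ)
    (hcomp : Q.IsCompatible x (j + 1) θ τ) :
    (∃ (θ' : genSubalg K Q.X j ≃ₐ[K] genSubalg K y j)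
        (τ' : ∀ i : Fin N, (j : ℕ) ≤ (i : ℕ) → genSubalg K y i ≃ₐ[K] genSubalg K y i),
        Q.IsPresentation y j θ' τ' ∧ Q.IsCompatible y j θ' τ') ∧
      x j = y j ∧
      IsRegularOreSet
        (Submonoid.powers (⟨x j, mem_genSubalg x j.isLt⟩ : genSubalg K x N)) ∧
      IsRegularOreSet
        (Submonoid.powers (⟨y j, mem_genSubalg y j.isLt⟩ : genSubalg K y N)) ∧
      rightFractions (genSubalg K y N) (y j) = rightFractions (genSubalg K x N) (x j) := by
  rw [Q.gens_castSucc, ← hx] at hy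
  subst hy
  clear hx
  have hxy : Q.deleteStep j x j = x j := deleteStep_of_le le_rfl
  have hxN : x j ∈ genSubalg K (Q.deleteStep j x) N := by
    simpa only [hxy] using mem_genSubalg (K := K) (Q.deleteStep j x) j.isLt
  refine ⟨⟨hpres.deletionEquiv hj, hpres.deletionAut hcomp hj, ⟨?_, ?_⟩, ⟨?_, ?_⟩⟩, hxy.symm,
    isRegularOreSet_powers _ _ (hpres.genSubalg_le_oreFractions hcomp hj j.isLt), ?_, ?_⟩
  · intro l hl
    rw [hpres.deletionEquiv_apply, hpres.deleteStep_of_lt hj hl]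
  · intro i hi
    have hyi : Q.deleteStep j x i = x i := deleteStep_of_le hi
    rw [hyi]
    refine isOreExtension_of_conj (hpres.gen_ne_zero hj hi) _
      (hpres.deletionAut_apply hcomp hj i hi) ?_ (hpres.gen_indep hcomp hj hi)
    rw [genSubalg_succ, hyi]
  · intro i hi l hl
    rw [hpres.deletionAut_apply]
    exact hpres.conj_deleteStep hcomp hj hi hl
  · intro i hi l hl0 hl n a
    simp only [hpres.deletionAut_apply, Subalgebra.coe_inclusion, hpres.deletionEquiv_apply]
    rcases hi.eq_or_lt with hi | hi
    · obtain rfl := Fin.ext hi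
      obtain ⟨b, hb, hb'⟩ := Q.σ_comp_d l j hl0 hl n a
      have hconj (r : genSubalg K Q.X j) : x j * (hpres.isDeletable hj).deletionHom r * (x j)⁻¹ =
          (hpres.isDeletable hj).deletionHom (Q.σ j r) := by
        rw [IsDeletable.deletionHom_apply, (hpres.isDeletable hj).mul_deletionFun, mul_assoc,
          mul_inv_cancel₀ (hpres.gen_ne_zero hj le_rfl), mul_one]
        rfl
      refine ⟨b, ?_, ?_⟩
      · rw [hconj]
        exact congrArg _ (Subtype.ext hb)
      · rw [hconj, ← map_smul]
        exact congrArg _ (Subtype.ext hb')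
    · obtain ⟨b, hb, hb'⟩ := hcomp.comp_d i hi l hl0 (hl.trans (Nat.lt_succ_self _)) n a
      rw [← hpres.conj_eq] at hb hb'
      obtain ⟨c, hc, hc'⟩ := hpres.conj_deletionHom hcomp hj hi
        (Subalgebra.inclusion (genSubalg_mono Q.X hl.le) a)
      obtain ⟨e, he, he'⟩ := hpres.conj_deletionHom hcomp hj hi
        (Subalgebra.inclusion (genSubalg_mono Q.X hl.le) (Q.d l n a))
      refine ⟨b, ?_, ?_⟩
      · rw [hc']
        congr 1
        exact Q.lowerEmb_injective θ (hc.symm.trans hb)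
      · rw [he', ← map_smul]
        congr 1
        apply Q.lowerEmb_injective θ
        rw [map_smul]
        exact he.symm.trans hb'
  · simp only [hxy]
    exact isRegularOreSet_powers _ _ (hpres.genSubalg_deleteStep_le hcomp hj hxN)
  · rw [hxy, rightFractions_eq_oreFractions _ hxN
      (hpres.genSubalg_deleteStep_le hcomp hj hxN),
      rightFractions_eq_oreFractions _ _ (hpres.genSubalg_le_oreFractions hcomp hj j.isLt),
      hpres.oreFractions_deleteStep hcomp hj j.isLt]
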